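/- Let $f:\mathbb R^d\to\mathbb R$ be continuously differentiable with a unique global minimizer $x^\ast$, and put $f^\ast=f(x^\ast)$. Let $\mu,L>0$ and assume that $f$ is $\mu$-Polyak--Łojasiewicz, $\|\nabla f(x)\|^2\ge 2\mu(f(x)-f^\ast)$ for all $x$, and $L$-smooth, $f(x)-f(y)-\langle\nabla f(y),x-y\rangle\le\frac L2\|x-y\|^2$ for all $x,y$. Put $$L_0=\inf\{L'\in(0,L]:\ f(x)-f^\ast\le\tfrac{L'}2\|x-x^\ast\|^2\ \ \forall x\},\qquad \mu_0=\sup\{\mu'\ge\mu:\ f(x)-f^\ast\ge\tfrac{\mu'}2\|x-x^\ast\|^2\ \ \forall x\}.$$ Let $\nabla f(x,\xi)$, with $\xi\sim\mathcal P$, be (jointly measurable, square-integrable) stochastic gradients such that $\mathbb E[\nabla f(x,\xi)]=\nabla f(x)$ and $\mathbb E\|\nabla f(x,\xi)\|^2\le\rho\|\nabla f(x)\|^2$ for all $x$, with $\rho\ge1$ (strong growth condition). Let $T_0=0$, let $(T_{k+1}-T_k)_{k\ge0}$ be i.i.d. exponential variables of parameter $1$, and let $(\xi_k)_{k\ge0}$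 be i.i.d. of law $\mathcal P$ and independent of $(T_k)_{k\ge 0}$. Let $a_{avg}>0$ and $$\theta=\eta'=\frac{a_{avg}}{\rho}\Bigl(\frac{\mu_0}{L_0}\Bigr)^{1/4}\sqrt{\frac{\mu}{L}},\quad \gamma=\frac1{\rho L},\quad \gamma'=\frac1{\rho(\mu_0L_0)^{1/4}\sqrt L},\quad \eta=\frac{(\mu_0L_0)^{1/4}}{\rho\sqrt L}.$$ Starting from a deterministic point $\tilde x_0=\tilde z_0$, consider Nesterov's algorithm with the continuized parameterization, $$\tilde y_k=\tilde x_k+\alpha_k(\tilde z_k-\tilde x_k),\quad \tilde x_{k+1}=\tilde y_k-\gamma\nabla f(\tilde y_k,\xi_k),\quad \tilde z_{k+1}=\tilde z_k+\beta_k(\tilde y_k-\tilde z_k)-\gamma'\nabla f(\tilde y_k,\xi_k),$$ $$\alpha_k=\frac{\eta}{\eta+\eta'}\bigl(1-e^{-(\eta+\eta')(T_{k+1}-T_k)}\bigr),\qquad \beta_k=\eta'\,\frac{1-e^{-(\eta+\eta')(T_{k+1}-T_k)}}{\eta'+\eta e^{-(\eta+\eta')(T_{k+1}-T_k)}}.$$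 Let $k\in\mathbb N$ and assume the averaged aiming condition: almost surely, $$\sum_{i=1}^{k}e^{\theta T_i}\Bigl[\langle\nabla f(\tilde y_{i-1},\xi_{i-1}),\tilde y_{i-1}-x^\ast\rangle-a_{avg}\|\nabla f(\tilde y_{i-1},\xi_{i-1})\|\,\|x^\ast-\tilde y_{i-1}\|\Bigr]\ge0$$ (the $i$-th term belongs to the gradient evaluated at time $T_i$). Then, for all $c_0>1$ and $c_1\in(0,1)$, with probability at least $1-\frac1{c_0}-e^{-((1-c_1)-1-\log(1-c_1))k}$, $$f(\tilde x_k)-f^\ast\le c_0\Bigl(1+\sqrt{\tfrac{L_0}{\mu_0}}\Bigr)(f(\tilde x_0)-f^\ast)\,\exp\bigl(-\theta(1-c_1)k\bigr).$$ -/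

import Mathlib

open MeasureTheory ProbabilityTheory
open scoped RealInnerProductSpace Gradient

namespace PLMomentum

/-- The space `ℝ^d` with its Euclidean norm. -/
abbrev Vec (d : ℕ) : Type := EuclideanSpace ℝ (Fin d)

section FunctionClasses

variable {d : ℕ}

/-- `x⋆` is the unique global minimizer of `f`; the minimal value `f⋆` is then `f x⋆`. -/
def IsUniqueMinimizer (f : Vec d → ℝ) (xs : Vec d) : Prop :=
  (∀ x, f xs ≤ f x) ∧ ∀ x, f x = f xs → x = xs

/-- Polyak–Łojasiewicz functions with constant `μ`: `‖∇f(x)‖² ≥ 2μ (f(x) - f⋆)`. -/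
def IsPL (μ : ℝ) (f : Vec d → ℝ) (xs : Vec d) : Prop :=
  0 < μ ∧ ∀ x, 2 * μ * (f x - f xs) ≤ ‖∇ f x‖ ^ 2

/-- `L`-smooth functions: `f(x) - f(y) - ⟨∇f(y), x - y⟩ ≤ (L/2) ‖x - y‖²`. -/
def IsLSmooth (L : ℝ) (f : Vec d → ℝ) : Prop :=
  0 < L ∧ ∀ x y, f x - f y - ⟪∇ f y, x - y⟫ ≤ L / 2 * ‖x - y‖ ^ 2

/-- Lower quadratic growth: `f(x) - f⋆ ≥ (m/2) ‖x - x⋆‖²`. -/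
def QGLower (m : ℝ) (f : Vec d → ℝ) (xs : Vec d) : Prop :=
  0 < m ∧ ∀ x, m / 2 * ‖x - xs‖ ^ 2 ≤ f x - f xs

/-- Upper quadratic growth: `f(x) - f⋆ ≤ (M/2) ‖x - x⋆‖²`. -/
def QGUpper (M : ℝ) (f : Vec d → ℝ) (xs : Vec d) : Prop :=
  0 < M ∧ ∀ x, f x - f xs ≤ M / 2 * ‖x - xs‖ ^ 2

end FunctionClasses

/-- Stochastic gradients `g x s = ∇f(x, s)`, with noise `s` of law `Q`, that are (jointly
measurable and) square integrable, unbiased, and satisfy the strong growth condition with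
constant `ρ ≥ 1`. -/
structure StrongGrowth {d : ℕ} {Ξ : Type*} [MeasurableSpace Ξ] (f : Vec d → ℝ)
    (g : Vec d → Ξ → Vec d) (Q : Measure Ξ) (ρ : ℝ) : Prop where
  measurable : Measurable (Function.uncurry g)
  memLp : ∀ x, MemLp (g x) 2 Q
  unbiased : ∀ x, ∫ s, g x s ∂Q = ∇ f x
  one_le : 1 ≤ ρ
  growth : ∀ x, ∫ s, ‖g x s‖ ^ 2 ∂Q ≤ ρ * ‖∇ f x‖ ^ 2

/-- Nesterov's momentum algorithm along one realization, with parameters `α k, β k, γ, γ'`;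
`G k` is the (stochastic) gradient map used at step `k`. -/
structure IsNesterov {d : ℕ} (α β : ℕ → ℝ) (γ γ' : ℝ) (G : ℕ → Vec d → Vec d)
    (x y z : ℕ → Vec d) : Prop where
  y_eq : ∀ k, y k = x k + α k • (z k - x k)
  x_succ : ∀ k, x (k + 1) = y k - γ • G k (y k)
  z_succ : ∀ k, z (k + 1) = z k + β k • (y k - z k) - γ' • G k (y k)

/-- The continuized parameter `α_k`, as a function of the waiting time `δ = T_{k+1} - T_k`. -/
noncomputable def contAlpha (η η' δ : ℝ) : ℝ :=
  η / (η + η') * (1 - Real.exp (-(η + η') * δ))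

/-- The continuized parameter `β_k`, as a function of the waiting time `δ = T_{k+1} - T_k`. -/
noncomputable def contBeta (η η' δ : ℝ) : ℝ :=
  η' * ((1 - Real.exp (-(η + η') * δ)) / (η' + η * Real.exp (-(η + η') * δ)))

/-- The randomness of the continuized method, a Poisson clock with i.i.d. marks: `T 0 = 0`, and
the pairs `(T (k+1) - T k, ξ k)` are independent over `k` with law `Exp(1) ⊗ Q`. Equivalently,
the waiting times are i.i.d. exponential of parameter `1`, the marks `ξ k` are i.i.d. of law `Q`,
and the two sequences are independent of each other. In particular `ξ k` is independent of all
that has been computed before the gradient of step `k` is sampled. -/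
structure IsMarkedPoissonClock {Ω Ξ : Type*} [MeasurableSpace Ω] [MeasurableSpace Ξ]
    (P : Measure Ω) (Q : Measure Ξ) (T : ℕ → Ω → ℝ) (ξ : ℕ → Ω → Ξ) : Prop where
  zero : ∀ ω, T 0 ω = 0
  law : ∀ k, HasLaw (fun ω => (T (k + 1) ω - T k ω, ξ k ω)) ((expMeasure 1).prod Q) P
  indep : iIndepFun (fun k ω => (T (k + 1) ω - T k ω, ξ k ω)) P

/-- The aiming condition with constant `a`, on weighted average over the first `k` gradient
evaluations, almost surely. The `i`-th evaluation (`i = 1, …, k`) takes place at the time `T i`,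
at the point `y (i - 1)` with the noise `ξ (i - 1)`, and has the weight `A i`; the sum below is
over `j = i - 1`. -/
def AveragedAiming {d : ℕ} {Ω Ξ : Type*} [MeasurableSpace Ω] (P : Measure Ω)
    (g : Vec d → Ξ → Vec d) (xs : Vec d) (a : ℝ) (A : ℕ → Ω → ℝ)
    (y : ℕ → Ω → Vec d) (ξ : ℕ → Ω → Ξ) (k : ℕ) : Prop :=
  ∀ᵐ ω ∂P, 0 ≤ ∑ j ∈ Finset.range k, A (j + 1) ω *
    (⟪g (y j ω) (ξ j ω), y j ω - xs⟫ - a * ‖g (y j ω) (ξ j ω)‖ * ‖xs - y j ω‖)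

end PLMomentum

namespace PLMomentum

open Set Filter Topology

/-! ### Descent, quadratic growth and the sharp growth constants. -/

section Deterministic

variable {d : ℕ} {f : Vec d → ℝ} {xs : Vec d} {μ L : ℝ}

/-! Between gradient evaluations the pair (x, z) follows the linear flow ẋ = η(z − x), ż = η'(x − z)
for an exponential time, and each evaluation makes it jump; α_k and β_k encode the exact solution of
the flow (`flowZ_eq`). Take Φ = f(x) − f* + (b/2)‖z − x*‖² with b = √(μ₀L₀), and weight it by
e^{θt}. For an Exp(1) time δ, E[h(δ) − h'(δ)] = h(0), so it suffices that the mean change of Φ at a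
jump, apart from η times the aiming deficit, offsets the infinitesimal growth of e^{θt}Φ along the
flow. There η = bγ' cancels the cross terms ⟨∇f(y), w − y⟩, the gain γ‖∇f‖² absorbs the noise
allowed by strong growth, and PL with the two quadratic growths bounds θ(f − f*) + (bθ/2)‖y − x*‖²
by ηa‖∇f‖‖y − x*‖ (`lyapunovParams_of_sharp_constants`).

Independence of the marks and waiting times carries this along the chain: E[e^{θT_k}Φ_k] is at most
Φ_0 plus η times the expected total deficit, which averaged aiming makes nonpositive
(`expected_lyapunov_le`). Since Φ_0 ≤ (1 + √(L₀/μ₀))(f(x₀) − f*), Markov's inequality and a Chernoff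
bound for T_k ≤ (1 − c₁)k conclude.

The expectations need θ < 1. By Cauchy–Schwarz, aiming with a > 1 forces x₀ = x*, where the method
stays; for a ≤ 1, θ ≥ 1 forces ρ = 1 and μ = L, and then one step almost surely reaches x*
(`ae_gradient_step_eq_min`). -/

theorem IsUniqueMinimizer.gradient_eq_zero (hxs : IsUniqueMinimizer f xs) : ∇ f xs = 0 := by
  have h : fderiv ℝ f xs = 0 :=
    IsLocalMin.fderiv_eq_zero (Filter.Eventually.of_forall hxs.1)
  simp [gradient, h]

/-- The descent inequality for a step along an arbitrary direction. -/
theorem IsLSmooth.sub_smul_le (hLS : IsLSmooth L f) (x v : Vec d) (c : ℝ) :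
    f (x - c • v) ≤ f x - c * ⟪∇ f x, v⟫ + L / 2 * c ^ 2 * ‖v‖ ^ 2 := by
  have h := hLS.2 (x - c • v) x
  have e : x - c • v - x = -(c • v) := by abel
  rw [e, inner_neg_right, real_inner_smul_right, norm_neg, norm_smul, mul_pow,
    Real.norm_eq_abs, sq_abs] at h
  linarith

theorem IsLSmooth.norm_gradient_sq_le (hLS : IsLSmooth L f) (hxs : IsUniqueMinimizer f xs)
    (x : Vec d) : ‖∇ f x‖ ^ 2 ≤ 2 * L * (f x - f xs) := by
  have hL := hLS.1
  have h := hLS.sub_smul_le x (∇ f x) (1 / L)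
  rw [real_inner_self_eq_norm_sq] at h
  have h2 := hxs.1 (x - (1 / L) • ∇ f x)
  have e : L / 2 * (1 / L) ^ 2 * ‖∇ f x‖ ^ 2 = 1 / L * ‖∇ f x‖ ^ 2 / 2 := by
    field_simp
  have h3 : 1 / L * ‖∇ f x‖ ^ 2 / 2 ≤ f x - f xs := by linarith
  have h4 : ‖∇ f x‖ ^ 2 = 2 * L * (1 / L * ‖∇ f x‖ ^ 2 / 2) := by field_simp
  rw [h4]
  gcongr

theorem IsLSmooth.qgUpper (hLS : IsLSmooth L f) (hxs : IsUniqueMinimizer f xs) :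
    QGUpper L f xs := by
  refine ⟨hLS.1, fun x => ?_⟩
  have h := hLS.2 x xs
  rw [hxs.gradient_eq_zero, inner_zero_left] at h
  linarith

/-- One gradient step with a small step size decreases `√(f - f⋆)` by a multiple of its length. -/
theorem sqrt_gradient_step (hPL : IsPL μ f xs) (hLS : IsLSmooth L f)
    (hxs : IsUniqueMinimizer f xs) {h : ℝ} (h0 : 0 < h) (h1 : L * h ≤ 1) (x : Vec d) :
    (1 - L * h / 2) * √(μ / 2) * (h * ‖∇ f x‖) ≤
      √(f x - f xs) - √(f (x - h • ∇ f x) - f xs) := by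
  have hμ := hPL.1
  set F := f x - f xs with hF
  set F' := f (x - h • ∇ f x) - f xs with hF'
  have hF0 : 0 ≤ F := sub_nonneg.2 (hxs.1 _)
  have hF0' : 0 ≤ F' := sub_nonneg.2 (hxs.1 _)
  have hd := hLS.sub_smul_le x (∇ f x) h
  rw [real_inner_self_eq_norm_sq] at hd
  set G := ‖∇ f x‖ with hG
  have hG0 : 0 ≤ G := norm_nonneg _
  have hdec : F' ≤ F - (1 - L * h / 2) * h * G ^ 2 := by
    have : L / 2 * h ^ 2 * G ^ 2 = (L * h / 2) * h * G ^ 2 := by ring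
    rw [hF, hF']; linarith
  have hpl : 2 * μ * F ≤ G ^ 2 := hPL.2 x
  have hc : 0 < 1 - L * h / 2 := by linarith
  have e1 : √F ^ 2 = F := Real.sq_sqrt hF0
  have e2 : √F' ^ 2 = F' := Real.sq_sqrt hF0'
  have em : √(μ / 2) ^ 2 = μ / 2 := Real.sq_sqrt (by positivity)
  have hsF := Real.sqrt_nonneg F
  have hsF' := Real.sqrt_nonneg F'
  have hsm := Real.sqrt_nonneg (μ / 2)
  -- The Polyak–Łojasiewicz inequality in square-root form.
  have hmF : 2 * √(μ / 2) * √F ≤ G := by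
    apply abs_le_of_sq_le_sq' _ hG0 |>.2
    calc (2 * √(μ / 2) * √F) ^ 2 = 4 * √(μ / 2) ^ 2 * √F ^ 2 := by ring
      _ = 2 * μ * F := by rw [em, e1]; ring
      _ ≤ _ := hpl
  rcases hsF.eq_or_lt with h00 | hpos
  · have hz : F = 0 := by rw [← e1, ← h00]; ring
    have hGz : G = 0 := by
      have h5 := hLS.norm_gradient_sq_le hxs x
      rw [← hF, ← hG, hz] at h5
      nlinarith
    have hz' : F' = 0 := by
      rw [hz, hGz] at hdec
      linarith [hdec, hF0', (by ring : (1 - L * h / 2) * h * (0 : ℝ) ^ 2 = 0)]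
    rw [hz, hz', hGz]; simp
  · have hle : √F' ≤ √F := by
      apply Real.sqrt_le_sqrt
      have : 0 ≤ (1 - L * h / 2) * h * G ^ 2 := by positivity
      linarith
    -- Concavity of the root, √F − √F' ≥ (F − F')/(2√F), multiplied out; one factor G of the
    -- decrease is traded for 2√(μ/2)√F.
    have key : (1 - L * h / 2) * √(μ / 2) * (h * G) * (2 * √F) ≤ (√F - √F') * (2 * √F) := by
      calc (1 - L * h / 2) * √(μ / 2) * (h * G) * (2 * √F)
          = (1 - L * h / 2) * h * G * (2 * √(μ / 2) * √F) := by ring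
        _ ≤ (1 - L * h / 2) * h * G * G := by gcongr
        _ ≤ √F ^ 2 - √F' ^ 2 := by rw [e1, e2]; linarith
        _ ≤ _ := by nlinarith
    exact le_of_mul_le_mul_right key (by positivity)

/-- Gradient descent converges to the minimizer, with the length of the path controlled. -/
theorem norm_sub_le_of_step (hf : Continuous f) (hPL : IsPL μ f xs) (hLS : IsLSmooth L f)
    (hxs : IsUniqueMinimizer f xs) {h : ℝ} (h0 : 0 < h) (h1 : L * h ≤ 1) (x : Vec d) :
    (1 - L * h / 2) * √(μ / 2) * ‖x - xs‖ ≤ √(f x - f xs) := by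
  have hμ := hPL.1
  have hL := hLS.1
  have hc : 0 < (1 - L * h / 2) * √(μ / 2) :=
    mul_pos (by linarith) (Real.sqrt_pos.2 (by positivity))
  set c := (1 - L * h / 2) * √(μ / 2)
  let u : ℕ → Vec d := fun n => (fun v => v - h • ∇ f v)^[n] x
  have hu : ∀ n, u (n + 1) = u n - h • ∇ f (u n) := fun n =>
    Function.iterate_succ_apply' _ _ _
  have hstep : ∀ n, c * ‖u n - u (n + 1)‖ ≤ √(f (u n) - f xs) - √(f (u (n + 1)) - f xs) := by
    intro n
    have := sqrt_gradient_step hPL hLS hxs h0 h1 (u n)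
    rw [hu n]
    simpa [norm_smul, abs_of_pos h0, mul_assoc, c] using this
  have hlen : ∀ n, c * ∑ i ∈ Finset.range n, ‖u i - u (i + 1)‖ ≤
      √(f x - f xs) - √(f (u n) - f xs) := by
    intro n
    induction n with
    | zero => simp [u]
    | succ n ih => rw [Finset.sum_range_succ, mul_add]; linarith [hstep n]
  have hsum : Summable fun i => ‖u i - u (i + 1)‖ := by
    refine summable_of_sum_range_le (c := √(f x - f xs) / c) (fun _ => norm_nonneg _) fun n => ?_
    rw [le_div_iff₀ hc, mul_comm]
    linarith [hlen n, Real.sqrt_nonneg (f (u n) - f xs)]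
  have hcau : CauchySeq u := by
    refine cauchySeq_of_summable_dist ?_
    simpa [dist_eq_norm] using hsum
  obtain ⟨w, hw⟩ := cauchySeq_tendsto_of_complete hcau
  have hdist : ∀ n, c * ‖x - u n‖ ≤ √(f x - f xs) := by
    intro n
    have h2 : ‖x - u n‖ ≤ ∑ i ∈ Finset.range n, ‖u i - u (i + 1)‖ := by
      have := dist_le_range_sum_dist u n
      simpa [dist_eq_norm, u] using this
    have := mul_le_mul_of_nonneg_left h2 hc.le
    linarith [hlen n, Real.sqrt_nonneg (f (u n) - f xs)]
  -- The step lengths are h‖∇f(u n)‖ and tend to 0, so by PL the limit has the minimal value.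
  have hws : w = xs := by
    apply hxs.2
    have t1 : Tendsto (fun n => ‖u n - u (n + 1)‖) atTop (𝓝 0) := hsum.tendsto_atTop_zero
    have t2 : Tendsto (fun n => f (u n) - f xs) atTop (𝓝 (f w - f xs)) :=
      ((hf.tendsto w).comp hw).sub_const _
    have t3 : Tendsto (fun n => ‖u n - u (n + 1)‖ ^ 2 / h ^ 2) atTop (𝓝 0) := by
      simpa using (t1.pow 2).div_const (h ^ 2)
    have h4 : ∀ n, 2 * μ * (f (u n) - f xs) ≤ ‖u n - u (n + 1)‖ ^ 2 / h ^ 2 := by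
      intro n
      have : ‖u n - u (n + 1)‖ ^ 2 / h ^ 2 = ‖∇ f (u n)‖ ^ 2 := by
        rw [hu n]
        simp only [sub_sub_cancel, norm_smul, Real.norm_eq_abs, mul_pow, sq_abs]
        field_simp
      rw [this]; exact hPL.2 _
    have h5 := le_of_tendsto_of_tendsto' (t2.const_mul (2 * μ)) t3 h4
    have h6 := hxs.1 w
    nlinarith
  have t : Tendsto (fun n => c * ‖x - u n‖) atTop (𝓝 (c * ‖x - xs‖)) := by
    rw [← hws]
    exact ((tendsto_const_nhds.sub hw).norm).const_mul c
  exact le_of_tendsto' t hdist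

/-- A smooth Polyak–Łojasiewicz function grows at least quadratically, with the same constant. -/
theorem IsPL.qgLower (hf : Continuous f) (hPL : IsPL μ f xs) (hLS : IsLSmooth L f)
    (hxs : IsUniqueMinimizer f xs) : QGLower μ f xs := by
  have hμ := hPL.1
  have hL := hLS.1
  refine ⟨hμ, fun x => ?_⟩
  -- Letting the step size tend to 0 removes the loss 1 − Lh/2 and leaves the constant μ itself.
  have t : Tendsto (fun h : ℝ => (1 - L * h / 2) * √(μ / 2) * ‖x - xs‖) (𝓝[>] 0)
      (𝓝 ((1 - L * 0 / 2) * √(μ / 2) * ‖x - xs‖)) :=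
    (Continuous.tendsto (by fun_prop) 0).mono_left nhdsWithin_le_nhds
  have hle : (1 - L * 0 / 2) * √(μ / 2) * ‖x - xs‖ ≤ √(f x - f xs) := by
    refine le_of_tendsto t ?_
    filter_upwards [Ioo_mem_nhdsGT (show (0 : ℝ) < 1 / L by positivity)] with h hh
    refine norm_sub_le_of_step hf hPL hLS hxs hh.1 ?_ x
    have := hh.2.le
    rw [le_div_iff₀ hL] at this
    linarith
  have h2 : (√(μ / 2) * ‖x - xs‖) ^ 2 ≤ √(f x - f xs) ^ 2 := by
    have h3 : √(μ / 2) * ‖x - xs‖ ≤ √(f x - f xs) := by simpa using hle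
    gcongr
  rwa [mul_pow, Real.sq_sqrt (by positivity), Real.sq_sqrt (sub_nonneg.2 (hxs.1 x))] at h2

/-- The sharp growth constants are attained, and ordered. -/
theorem sharp_growth_constants {L₀ μ₀ : ℝ} (hf : Continuous f) (hPL : IsPL μ f xs)
    (hLS : IsLSmooth L f) (hxs : IsUniqueMinimizer f xs)
    (hL₀ : L₀ = sInf {L' : ℝ | L' ≤ L ∧ QGUpper L' f xs})
    (hμ₀ : μ₀ = sSup {μ' : ℝ | μ ≤ μ' ∧ QGLower μ' f xs}) {x₀ : Vec d} (hx₀ : x₀ ≠ xs) :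
    QGLower μ₀ f xs ∧ QGUpper L₀ f xs ∧ μ ≤ μ₀ ∧ μ₀ ≤ L₀ ∧ L₀ ≤ L := by
  have hμ := hPL.1
  have hr : 0 < ‖x₀ - xs‖ := norm_pos_iff.2 (sub_ne_zero.2 hx₀)
  have hLmem : L ∈ {L' : ℝ | L' ≤ L ∧ QGUpper L' f xs} := ⟨le_rfl, hLS.qgUpper hxs⟩
  have hμmem : μ ∈ {μ' : ℝ | μ ≤ μ' ∧ QGLower μ' f xs} := ⟨le_rfl, hPL.qgLower hf hLS hxs⟩
  have hbdd : BddBelow {L' : ℝ | L' ≤ L ∧ QGUpper L' f xs} := ⟨0, fun l hl => hl.2.1.le⟩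
  have hcmp : ∀ m M : ℝ, QGLower m f xs → QGUpper M f xs → m ≤ M := by
    intro m M hm hM
    have h := (hm.2 x₀).trans (hM.2 x₀)
    have h2 := le_of_mul_le_mul_right h (by positivity)
    linarith
  have hbdd' : BddAbove {μ' : ℝ | μ ≤ μ' ∧ QGLower μ' f xs} :=
    ⟨L, fun l hl => hcmp _ _ hl.2 hLmem.2⟩
  have hμle : μ ≤ μ₀ := hμ₀ ▸ le_csSup hbdd' hμmem
  have hLle : L₀ ≤ L := hL₀ ▸ csInf_le hbdd hLmem
  have hmL : μ₀ ≤ L₀ := by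
    rw [hL₀, hμ₀]
    exact csSup_le ⟨_, hμmem⟩ fun m hm => le_csInf ⟨_, hLmem⟩ fun M hM => hcmp m M hm.2 hM.2
  refine ⟨⟨by linarith, fun x => ?_⟩, ⟨by linarith, fun x => ?_⟩, hμle, hmL, hLle⟩
  · rcases eq_or_ne x xs with rfl | hne
    · simp
    have hr : 0 < ‖x - xs‖ := norm_pos_iff.2 (sub_ne_zero.2 hne)
    have : μ₀ ≤ (f x - f xs) * 2 / ‖x - xs‖ ^ 2 := by
      rw [hμ₀]
      refine csSup_le ⟨_, hμmem⟩ fun m hm => ?_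
      rw [le_div_iff₀ (by positivity)]
      linarith [hm.2.2 x]
    rw [le_div_iff₀ (by positivity)] at this
    linarith
  · rcases eq_or_ne x xs with rfl | hne
    · simp
    have hr : 0 < ‖x - xs‖ := norm_pos_iff.2 (sub_ne_zero.2 hne)
    have : (f x - f xs) * 2 / ‖x - xs‖ ^ 2 ≤ L₀ := by
      rw [hL₀]
      refine le_csInf ⟨_, hLmem⟩ fun m hm => ?_
      rw [div_le_iff₀ (by positivity)]
      linarith [hm.2.2 x]
    rw [div_le_iff₀ (by positivity)] at this
    linarith

end Deterministic

/-! ### The exponential law of parameter 1. -/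

section Exponential

theorem expMeasure_one_eq : expMeasure 1 =
    (volume.restrict (Ioi 0)).withDensity fun s => ENNReal.ofReal (Real.exp (-s)) := by
  rw [expMeasure, gammaMeasure, ← withDensity_indicator measurableSet_Ioi]
  refine withDensity_congr_ae ?_
  -- The two densities differ only at 0.
  have : ∀ᵐ s : ℝ, s ≠ 0 := by simp [ae_iff]
  filter_upwards [this] with s hs
  rw [gammaPDF_eq]
  rcases lt_or_gt_of_ne hs with h | h
  · simp [h.not_ge, h.not_gt, indicator]
  · simp [h.le, indicator, h]

theorem integral_expMeasure_one (h : ℝ → ℝ) :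
    ∫ s, h s ∂(expMeasure 1) = ∫ s in Ioi 0, Real.exp (-s) * h s := by
  rw [expMeasure_one_eq, integral_withDensity_eq_integral_toReal_smul (by fun_prop) (by simp)]
  simp [ENNReal.toReal_ofReal, Real.exp_nonneg]

theorem integrable_expMeasure_one_iff (h : ℝ → ℝ) :
    Integrable h (expMeasure 1) ↔ IntegrableOn (fun s => Real.exp (-s) * h s) (Ioi 0) := by
  rw [expMeasure_one_eq, integrable_withDensity_iff (by fun_prop) (by simp)]
  simp [ENNReal.toReal_ofReal, Real.exp_nonneg, IntegrableOn, mul_comm]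

theorem ae_expMeasure_one_pos : ∀ᵐ s ∂(expMeasure 1), 0 < s := by
  rw [expMeasure_one_eq]
  exact (withDensity_absolutelyContinuous _ _).ae_le (ae_restrict_mem measurableSet_Ioi)

theorem integrable_exp_mul_expMeasure_one {c : ℝ} (hc : c < 1) :
    Integrable (fun s => Real.exp (c * s)) (expMeasure 1) := by
  rw [integrable_expMeasure_one_iff]
  refine (integrableOn_exp_mul_Ioi (a := c - 1) (by linarith) 0).congr_fun (fun s _ => ?_)
    measurableSet_Ioi
  simp only [← Real.exp_add]; congr 1; ring

theorem integral_exp_mul_expMeasure_one {c : ℝ} (hc : c < 1) :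
    ∫ s, Real.exp (c * s) ∂(expMeasure 1) = (1 - c)⁻¹ := by
  rw [integral_expMeasure_one]
  have : ∀ s : ℝ, Real.exp (-s) * Real.exp (c * s) = Real.exp ((c - 1) * s) := fun s => by
    rw [← Real.exp_add]; congr 1; ring
  simp_rw [this]
  rw [integral_exp_mul_Ioi (by linarith)]
  have h1 : c - 1 ≠ 0 := by linarith
  have h2 : 1 - c ≠ 0 := by linarith
  simp only [mul_zero, Real.exp_zero]
  rw [neg_div, ← div_neg, neg_sub, one_div]

/-- Integration by parts against the exponential law of parameter `1`. -/
theorem integral_sub_deriv_expMeasure_one {h h' : ℝ → ℝ} (hd : ∀ s, HasDerivAt h (h' s) s)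
    (hint : Integrable (fun s => h s - h' s) (expMeasure 1))
    (hlim : Tendsto (fun s => Real.exp (-s) * h s) atTop (𝓝 0)) :
    ∫ s, (h s - h' s) ∂(expMeasure 1) = h 0 := by
  rw [integral_expMeasure_one]
  rw [integrable_expMeasure_one_iff] at hint
  have := integral_Ioi_of_hasDerivAt_of_tendsto' (a := 0) (f := fun s => -(Real.exp (-s) * h s))
    (f' := fun s => Real.exp (-s) * (h s - h' s)) (m := 0) (fun s _ => ?_) hint
    (by simpa using hlim.neg)
  · simpa using this
  · have h1 : HasDerivAt (fun s : ℝ => Real.exp (-s)) (-Real.exp (-s)) s := by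
      simpa using (hasDerivAt_neg s).exp
    convert (h1.fun_mul (hd s)).fun_neg using 1
    ring

end Exponential

/-! ### The linear flow between two gradient evaluations. -/

section Flow

variable {d : ℕ}

/-- The first component of the momentum flow `ẋ = η (z - x)`, `ż = η' (x - z)`. -/
noncomputable def flowX (η η' : ℝ) (x z : Vec d) (δ : ℝ) : Vec d :=
  x + contAlpha η η' δ • (z - x)

/-- The second component of the momentum flow, written with the parameter `contBeta`. -/
noncomputable def flowZ (η η' : ℝ) (x z : Vec d) (δ : ℝ) : Vec d :=
  z + contBeta η η' δ • (flowX η η' x z δ - z)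

variable {η η' : ℝ} (hη : 0 < η) (hη' : 0 < η') (x z xs : Vec d)

include hη hη'

/-- The denominator in β is (η + η')(1 − α): it compensates for the update of z being written with
y, where y − z = (1 − α)(x − z). What remains is the formula for x with η and η' exchanged. -/
theorem flowZ_eq (δ : ℝ) : flowZ η η' x z δ = z + contAlpha η' η δ • (x - z) := by
  have h : contBeta η η' δ * (1 - contAlpha η η' δ) = contAlpha η' η δ := by
    simp only [contBeta, contAlpha, add_comm η' η]
    set e := Real.exp (-(η + η') * δ)
    have he : 0 < e := Real.exp_pos _
    have : η' + η * e ≠ 0 := by positivity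
    field_simp
    ring
  rw [flowZ, flowX, ← h]
  module

theorem flowZ_sub_flowX (δ : ℝ) :
    flowZ η η' x z δ - flowX η η' x z δ = Real.exp (-(η + η') * δ) • (z - x) := by
  have h : 1 - contAlpha η' η δ - contAlpha η η' δ = Real.exp (-(η + η') * δ) := by
    simp only [contAlpha, add_comm η' η]
    field_simp
    ring
  rw [flowZ_eq hη hη', flowX, ← h]
  module

theorem hasDerivAt_contAlpha (δ : ℝ) :
    HasDerivAt (contAlpha η η') (η * Real.exp (-(η + η') * δ)) δ := by
  have h := (((hasDerivAt_id δ).const_mul (-(η + η'))).exp.const_sub 1).const_mul (η / (η + η'))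
  refine HasDerivAt.congr_deriv (f := contAlpha η η') h ?_
  simp only [id]
  field_simp

theorem hasDerivAt_flowX (δ : ℝ) :
    HasDerivAt (flowX η η' x z) (η • (flowZ η η' x z δ - flowX η η' x z δ)) δ := by
  rw [flowZ_sub_flowX hη hη', smul_smul]
  exact ((hasDerivAt_contAlpha hη hη' δ).smul_const (z - x)).const_add x

theorem hasDerivAt_flowZ (δ : ℝ) :
    HasDerivAt (flowZ η η' x z) (η' • (flowX η η' x z δ - flowZ η η' x z δ)) δ := by
  rw [← neg_sub (flowZ η η' x z δ), flowZ_sub_flowX hη hη', ← smul_neg, neg_sub, smul_smul,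
    funext (flowZ_eq hη hη' x z), add_comm η]
  exact ((hasDerivAt_contAlpha hη' hη δ).smul_const (x - z)).const_add z

theorem contAlpha_mem_Icc {δ : ℝ} (hδ : 0 ≤ δ) : contAlpha η η' δ ∈ Icc (0 : ℝ) 1 := by
  have he : Real.exp (-(η + η') * δ) ≤ 1 :=
    Real.exp_le_one_iff.2 (mul_nonpos_of_nonpos_of_nonneg (by linarith) hδ)
  have he0 := Real.exp_pos (-(η + η') * δ)
  have h1 : η / (η + η') ≤ 1 := by rw [div_le_one (by positivity)]; linarith
  have h0 : 0 ≤ η / (η + η') := by positivity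
  exact ⟨mul_nonneg h0 (by linarith), mul_le_one₀ h1 (by linarith) (by linarith)⟩

-- Convexity of the squared norm, weakened to a bound free of c; it serves only integrability.
omit hη hη' in
theorem norm_add_smul_sub_sq_le {c : ℝ} (hc : c ∈ Icc (0 : ℝ) 1) :
    ‖x + c • (z - x) - xs‖ ^ 2 ≤ ‖x - xs‖ ^ 2 + ‖z - xs‖ ^ 2 := by
  have e : x + c • (z - x) - xs = (1 - c) • (x - xs) + c • (z - xs) := by module
  have h : ‖x + c • (z - x) - xs‖ ≤ (1 - c) * ‖x - xs‖ + c * ‖z - xs‖ := by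
    rw [e]
    refine (norm_add_le _ _).trans_eq ?_
    rw [norm_smul, norm_smul, Real.norm_of_nonneg hc.1, Real.norm_of_nonneg (by linarith [hc.2])]
  have h1 : (1 - c) * ‖x - xs‖ ≤ ‖x - xs‖ := by
    nlinarith [norm_nonneg (x - xs), hc.1]
  have h2 : c * ‖z - xs‖ ≤ ‖z - xs‖ := by
    nlinarith [norm_nonneg (z - xs), hc.2]
  have hcv : ((1 - c) * ‖x - xs‖ + c * ‖z - xs‖) ^ 2 ≤
      (1 - c) * ‖x - xs‖ ^ 2 + c * ‖z - xs‖ ^ 2 := by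
    nlinarith [mul_nonneg (mul_nonneg hc.1 (sub_nonneg.2 hc.2))
      (sq_nonneg (‖x - xs‖ - ‖z - xs‖))]
  calc _ ≤ ((1 - c) * ‖x - xs‖ + c * ‖z - xs‖) ^ 2 := by gcongr
    _ ≤ (1 - c) * ‖x - xs‖ ^ 2 + c * ‖z - xs‖ ^ 2 := hcv
    _ ≤ _ := by nlinarith [mul_nonneg hc.1 (sq_nonneg ‖x - xs‖),
                  mul_nonneg (sub_nonneg.2 hc.2) (sq_nonneg ‖z - xs‖)]

theorem norm_flowX_sub_sq_le {δ : ℝ} (hδ : 0 ≤ δ) :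
    ‖flowX η η' x z δ - xs‖ ^ 2 ≤ ‖x - xs‖ ^ 2 + ‖z - xs‖ ^ 2 :=
  norm_add_smul_sub_sq_le _ _ _ (contAlpha_mem_Icc hη hη' hδ)

theorem norm_flowZ_sub_sq_le {δ : ℝ} (hδ : 0 ≤ δ) :
    ‖flowZ η η' x z δ - xs‖ ^ 2 ≤ ‖x - xs‖ ^ 2 + ‖z - xs‖ ^ 2 := by
  rw [flowZ_eq hη hη', add_comm (‖x - xs‖ ^ 2)]
  exact norm_add_smul_sub_sq_le z x xs (contAlpha_mem_Icc hη' hη hδ)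

end Flow

/-! ### The Lyapunov function over one flow and one jump. -/

/-- The Lyapunov function of the momentum method. -/
noncomputable def lyapunov {d : ℕ} (f : Vec d → ℝ) (xs : Vec d) (b : ℝ) (x z : Vec d) : ℝ :=
  f x - f xs + b / 2 * ‖z - xs‖ ^ 2

/-- Relations between the parameters that make the Lyapunov function decrease on average. -/
structure LyapunovParams {d : ℕ} (f : Vec d → ℝ) (xs : Vec d) (L ρ a θ η γ γ' b : ℝ) : Prop where
  a_pos : 0 < a
  θ_pos : 0 < θ
  η_pos : 0 < η
  b_pos : 0 < b
  η_eq : η = b * γ'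
  balance : (L / 2 * γ ^ 2 + b / 2 * γ' ^ 2) * ρ ≤ γ
  dominated : ∀ x, θ * (f x - f xs) + b * θ / 2 * ‖x - xs‖ ^ 2 ≤
    η * (a * ‖∇ f x‖ * ‖xs - x‖)

section OneStep

variable {d : ℕ} {Ξ : Type*} [MeasurableSpace Ξ] {Q : Measure Ξ} [IsProbabilityMeasure Q]
  {f : Vec d → ℝ} {xs : Vec d} {g : Vec d → Ξ → Vec d} {L ρ a θ η γ γ' b : ℝ}

/-- The deficit in the aiming condition at `y`, with noise `s`. -/
noncomputable def aimingDeficit (g : Vec d → Ξ → Vec d) (xs : Vec d) (a : ℝ) (y : Vec d) (s : Ξ) :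
    ℝ := a * ‖g y s‖ * ‖xs - y‖ - ⟪g y s, y - xs⟫

-- Expanding the square at the jump produces −η⟨g, w − xs⟩, because bγ' = η. Split at y, its part
-- along y − xs is cancelled by the inner product in the deficit; only the norm product of the
-- aiming condition survives.
omit [MeasurableSpace Ξ] in
theorem lyapunov_jump_le (hLS : IsLSmooth L f)
    (hp : LyapunovParams f xs L ρ a θ η γ γ' b) (y w : Vec d) (s : Ξ) :
    lyapunov f xs b (y - γ • g y s) (w - γ' • g y s) - η * aimingDeficit g xs a y s ≤
      lyapunov f xs b y w - ⟪γ • ∇ f y + η • (w - y), g y s⟫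
        + (L / 2 * γ ^ 2 + b / 2 * γ' ^ 2) * ‖g y s‖ ^ 2 - η * a * ‖xs - y‖ * ‖g y s‖ := by
  have h := hLS.sub_smul_le y (g y s) γ
  have e : ‖w - γ' • g y s - xs‖ ^ 2 =
      ‖w - xs‖ ^ 2 - 2 * γ' * ⟪g y s, w - xs⟫ + γ' ^ 2 * ‖g y s‖ ^ 2 := by
    rw [show w - γ' • g y s - xs = (w - xs) - γ' • g y s by abel, norm_sub_sq_real,
      real_inner_smul_right, norm_smul, mul_pow, Real.norm_eq_abs, sq_abs, real_inner_comm]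
    ring
  have e2 : ⟪g y s, w - xs⟫ = ⟪g y s, w - y⟫ + ⟪g y s, y - xs⟫ := by
    rw [← inner_add_right]; congr 1; abel
  have e3 : ⟪γ • ∇ f y + η • (w - y), g y s⟫ = γ * ⟪∇ f y, g y s⟫ + η * ⟪g y s, w - y⟫ := by
    rw [inner_add_left, real_inner_smul_left, real_inner_smul_left, real_inner_comm (w - y)]
  rw [lyapunov, lyapunov, aimingDeficit, e, e2, e3, hp.η_eq]
  linarith

theorem StrongGrowth.integrable (hg : StrongGrowth f g Q ρ) (y : Vec d) : Integrable (g y) Q :=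
  (hg.memLp y).integrable (by norm_num)

omit [IsProbabilityMeasure Q] in
theorem StrongGrowth.integrable_norm_sq (hg : StrongGrowth f g Q ρ) (y : Vec d) :
    Integrable (fun s => ‖g y s‖ ^ 2) Q := (hg.memLp y).integrable_norm_pow (by norm_num)

/-- Unbiasedness turns g into ∇f in the linear terms, strong growth and `balance` absorb the
quadratic one, and E‖g‖ ≥ ‖∇f‖ brings the norm product into the form that `dominated` needs. -/
theorem integral_lyapunov_jump_le (hLS : IsLSmooth L f)
    (hg : StrongGrowth f g Q ρ) (hp : LyapunovParams f xs L ρ a θ η γ γ' b) (y w : Vec d)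
    (hint : Integrable (fun s => lyapunov f xs b (y - γ • g y s) (w - γ' • g y s)
      - η * aimingDeficit g xs a y s) Q) :
    ∫ s, (lyapunov f xs b (y - γ • g y s) (w - γ' • g y s) - η * aimingDeficit g xs a y s) ∂Q ≤
      lyapunov f xs b y w - η * ⟪∇ f y, w - y⟫ - θ * (f y - f xs)
        - b * θ / 2 * ‖y - xs‖ ^ 2 := by
  have hL := hLS.1
  have i1 := hg.integrable y
  have i2 := hg.integrable_norm_sq y
  set v := γ • ∇ f y + η • (w - y) with hv
  set κ := L / 2 * γ ^ 2 + b / 2 * γ' ^ 2 with hκ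
  have hκ0 : 0 ≤ κ := by have := hp.b_pos; positivity
  have i3 : Integrable (fun s => ⟪v, g y s⟫) Q := i1.const_inner v
  have i4 : Integrable (fun s => lyapunov f xs b y w - ⟪v, g y s⟫) Q :=
    (integrable_const _).sub i3
  have i5 : Integrable (fun s => lyapunov f xs b y w - ⟪v, g y s⟫ + κ * ‖g y s‖ ^ 2) Q :=
    i4.add (i2.const_mul κ)
  have i6 : Integrable (fun s => η * a * ‖xs - y‖ * ‖g y s‖) Q := i1.norm.const_mul _
  refine (integral_mono hint (i5.sub i6) fun s => lyapunov_jump_le hLS hp y w s).trans ?_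
  simp only [Pi.sub_apply]
  rw [integral_sub i5 i6, integral_add i4 (i2.const_mul κ),
    integral_sub (integrable_const _) i3, integral_const_mul, integral_const_mul,
    integral_inner i1, hg.unbiased]
  simp only [integral_const, probReal_univ, one_smul]
  have e3 : ⟪v, ∇ f y⟫ = γ * ‖∇ f y‖ ^ 2 + η * ⟪∇ f y, w - y⟫ := by
    rw [hv, inner_add_left, real_inner_smul_left, real_inner_smul_left, real_inner_comm (w - y),
      real_inner_self_eq_norm_sq]
  have h1 : κ * ∫ s, ‖g y s‖ ^ 2 ∂Q ≤ γ * ‖∇ f y‖ ^ 2 := by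
    calc κ * ∫ s, ‖g y s‖ ^ 2 ∂Q ≤ κ * (ρ * ‖∇ f y‖ ^ 2) := by gcongr; exact hg.growth y
      _ = κ * ρ * ‖∇ f y‖ ^ 2 := by ring
      _ ≤ _ := by gcongr; exact hp.balance
  have h2 : η * a * ‖xs - y‖ * ‖∇ f y‖ ≤ η * a * ‖xs - y‖ * ∫ s, ‖g y s‖ ∂Q := by
    have := hp.η_pos
    have := hp.a_pos
    gcongr
    rw [← hg.unbiased]
    exact norm_integral_le_integral_norm _
  have h3 := hp.dominated y
  rw [e3]
  linarith

/-- The derivative of `δ ↦ e^{θ δ} Φ(X δ, Z δ)` along the momentum flow. -/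
theorem hasDerivAt_lyapunov_flow (hf : ContDiff ℝ 1 f) (hη : 0 < η) (hθ : 0 < θ)
    (x z : Vec d) (δ : ℝ) :
    HasDerivAt (fun δ => Real.exp (θ * δ) * lyapunov f xs b (flowX η θ x z δ) (flowZ η θ x z δ))
      (Real.exp (θ * δ) * (θ * lyapunov f xs b (flowX η θ x z δ) (flowZ η θ x z δ)
        + η * ⟪∇ f (flowX η θ x z δ), flowZ η θ x z δ - flowX η θ x z δ⟫
        + b * θ * ⟪flowX η θ x z δ - flowZ η θ x z δ, flowZ η θ x z δ - xs⟫)) δ := by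
  have hX := hasDerivAt_flowX hη hθ x z δ
  have hZ := hasDerivAt_flowZ hη hθ x z δ
  have h1 : HasDerivAt (fun δ => Real.exp (θ * δ)) (Real.exp (θ * δ) * θ) δ := by
    simpa using ((hasDerivAt_id δ).const_mul θ).exp
  have h2 := ((hf.differentiable one_ne_zero) (flowX η θ x z δ)).hasFDerivAt.comp_hasDerivAt δ hX
  rw [← inner_gradient_left, real_inner_smul_right] at h2
  have h3 := (hZ.sub_const xs).norm_sq
  rw [real_inner_smul_right, real_inner_comm (flowX η θ x z δ - flowZ η θ x z δ)] at h3
  refine HasDerivAt.congr_deriv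
    (f := fun δ => Real.exp (θ * δ) * lyapunov f xs b (flowX η θ x z δ) (flowZ η θ x z δ))
    (h1.fun_mul ((h2.sub_const (f xs)).fun_add (h3.const_mul (b / 2)))) ?_
  simp only [lyapunov]
  ring

/-- The bound after a jump meets the integrand of the integration by parts: the flow of z
contributes −(bθ/2)‖y − w‖² to the growth, and this term is dropped. -/
theorem lyapunov_sub_deriv_ge (hp : LyapunovParams f xs L ρ a θ η γ γ' b) (y w v : Vec d) :
    lyapunov f xs b y w - η * ⟪v, w - y⟫ - θ * (f y - f xs) - b * θ / 2 * ‖y - xs‖ ^ 2 ≤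
      lyapunov f xs b y w - (θ * lyapunov f xs b y w + η * ⟪v, w - y⟫
        + b * θ * ⟪y - w, w - xs⟫) := by
  have e : ‖y - xs‖ ^ 2 = ‖y - w‖ ^ 2 + 2 * ⟪y - w, w - xs⟫ + ‖w - xs‖ ^ 2 := by
    rw [← norm_add_sq_real, sub_add_sub_cancel]
  have h : 0 ≤ b * θ / 2 * ‖y - w‖ ^ 2 := by
    have := hp.b_pos; have := hp.θ_pos; positivity
  rw [e]
  simp only [lyapunov]
  linarith

theorem continuous_gradient (hf : ContDiff ℝ 1 f) : Continuous (∇ f) :=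
  (InnerProductSpace.toDual ℝ (Vec d)).symm.continuous.comp (hf.continuous_fderiv one_ne_zero)

/-- A continuous function of the position stays bounded along the momentum flow. -/
theorem exists_bound_flow (hη : 0 < η) (hθ : 0 < θ) (x z : Vec d) {F : Vec d × Vec d → ℝ}
    (hF : Continuous F) :
    ∃ C, ∀ δ, 0 ≤ δ → ‖F (flowX η θ x z δ, flowZ η θ x z δ)‖ ≤ C := by
  -- Time enters the flow only through two coefficients in [0, 1], so a maximum over the unit square
  -- suffices.
  obtain ⟨C, hC⟩ := (isCompact_Icc (a := (0 : ℝ)) (b := 1)).prod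
    (isCompact_Icc (a := (0 : ℝ)) (b := 1)) |>.exists_bound_of_continuousOn
    (f := fun c : ℝ × ℝ => F (x + c.1 • (z - x), z + c.2 • (x - z))) (by fun_prop)
  refine ⟨C, fun δ hδ => ?_⟩
  rw [flowZ_eq hη hθ]
  exact hC (contAlpha η θ δ, contAlpha θ η δ)
    ⟨contAlpha_mem_Icc hη hθ hδ, contAlpha_mem_Icc hθ hη hδ⟩

/-- Averaged over an exponential waiting time, the growth of the Lyapunov function along the flow
is what the integration by parts gives. -/
theorem integral_lyapunov_flow (hf : ContDiff ℝ 1 f) (hη : 0 < η) (hθ : 0 < θ) (hθ1 : θ < 1)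
    (x z : Vec d) :
    Integrable (fun δ => Real.exp (θ * δ) * (lyapunov f xs b (flowX η θ x z δ) (flowZ η θ x z δ) -
      (θ * lyapunov f xs b (flowX η θ x z δ) (flowZ η θ x z δ)
        + η * ⟪∇ f (flowX η θ x z δ), flowZ η θ x z δ - flowX η θ x z δ⟫
        + b * θ * ⟪flowX η θ x z δ - flowZ η θ x z δ, flowZ η θ x z δ - xs⟫))) (expMeasure 1) ∧
    ∫ δ, Real.exp (θ * δ) * (lyapunov f xs b (flowX η θ x z δ) (flowZ η θ x z δ) -
      (θ * lyapunov f xs b (flowX η θ x z δ) (flowZ η θ x z δ)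
        + η * ⟪∇ f (flowX η θ x z δ), flowZ η θ x z δ - flowX η θ x z δ⟫
        + b * θ * ⟪flowX η θ x z δ - flowZ η θ x z δ, flowZ η θ x z δ - xs⟫)) ∂(expMeasure 1)
      = lyapunov f xs b x z := by
  have hcf := hf.continuous
  have hcg := continuous_gradient hf
  have hX : Continuous (flowX η θ x z) :=
    continuous_iff_continuousAt.2 fun δ => (hasDerivAt_flowX hη hθ x z δ).continuousAt
  have hZ : Continuous (flowZ η θ x z) :=
    continuous_iff_continuousAt.2 fun δ => (hasDerivAt_flowZ hη hθ x z δ).continuousAt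
  obtain ⟨C, hC⟩ := exists_bound_flow hη hθ x z (F := fun p => lyapunov f xs b p.1 p.2 -
      (θ * lyapunov f xs b p.1 p.2 + η * ⟪∇ f p.1, p.2 - p.1⟫ + b * θ * ⟪p.1 - p.2, p.2 - xs⟫))
      (by unfold lyapunov; fun_prop)
  obtain ⟨C', hC'⟩ := exists_bound_flow hη hθ x z (F := fun p => lyapunov f xs b p.1 p.2)
      (by unfold lyapunov; fun_prop)
  have hint : Integrable (fun δ => Real.exp (θ * δ) *
      (lyapunov f xs b (flowX η θ x z δ) (flowZ η θ x z δ) -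
      (θ * lyapunov f xs b (flowX η θ x z δ) (flowZ η θ x z δ)
        + η * ⟪∇ f (flowX η θ x z δ), flowZ η θ x z δ - flowX η θ x z δ⟫
        + b * θ * ⟪flowX η θ x z δ - flowZ η θ x z δ, flowZ η θ x z δ - xs⟫))) (expMeasure 1) := by
    refine ((integrable_exp_mul_expMeasure_one hθ1).mul_const C).mono' ?_ ?_
    · refine Continuous.aestronglyMeasurable ?_
      unfold lyapunov
      fun_prop
    · filter_upwards [ae_expMeasure_one_pos] with δ hδ
      rw [norm_mul, Real.norm_of_nonneg (Real.exp_nonneg _)]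
      exact mul_le_mul_of_nonneg_left (hC δ hδ.le) (Real.exp_nonneg _)
  refine ⟨hint, ?_⟩
  have key := integral_sub_deriv_expMeasure_one
    (hasDerivAt_lyapunov_flow (xs := xs) (b := b) hf hη hθ x z) (by simpa [mul_sub] using hint) ?_
  · simp only [← mul_sub] at key
    rw [key, flowZ_eq hη hθ]
    simp [flowX, contAlpha]
  -- The boundary term at infinity vanishes because θ < 1.
  · have h0 : Tendsto (fun δ : ℝ => Real.exp ((θ - 1) * δ) * C') atTop (𝓝 0) := by
      have : Tendsto (fun δ : ℝ => Real.exp ((θ - 1) * δ)) atTop (𝓝 0) :=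
        Real.tendsto_exp_atBot.comp (tendsto_id.const_mul_atTop_of_neg (by linarith))
      simpa using this.mul_const C'
    refine squeeze_zero_norm' ?_ h0
    filter_upwards [eventually_ge_atTop 0] with δ hδ
    rw [← mul_assoc, ← Real.exp_add, norm_mul, Real.norm_of_nonneg (Real.exp_nonneg _),
      show -δ + θ * δ = (θ - 1) * δ by ring]
    exact mul_le_mul_of_nonneg_left (hC' δ hδ) (Real.exp_nonneg _)

/-- One flow-and-jump step of the continuized method. -/
theorem integral_lyapunov_step_le (hf : ContDiff ℝ 1 f) (hLS : IsLSmooth L f)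
    (hg : StrongGrowth f g Q ρ) (hp : LyapunovParams f xs L ρ a θ η γ γ' b) (hθ1 : θ < 1)
    (x z : Vec d)
    (hint : Integrable (fun u : ℝ × Ξ => Real.exp (θ * u.1) *
      (lyapunov f xs b (flowX η θ x z u.1 - γ • g (flowX η θ x z u.1) u.2)
        (flowZ η θ x z u.1 - γ' • g (flowX η θ x z u.1) u.2)
        - η * aimingDeficit g xs a (flowX η θ x z u.1) u.2)) ((expMeasure 1).prod Q)) :
    ∫ u : ℝ × Ξ, Real.exp (θ * u.1) *
      (lyapunov f xs b (flowX η θ x z u.1 - γ • g (flowX η θ x z u.1) u.2)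
        (flowZ η θ x z u.1 - γ' • g (flowX η θ x z u.1) u.2)
        - η * aimingDeficit g xs a (flowX η θ x z u.1) u.2) ∂((expMeasure 1).prod Q) ≤
      lyapunov f xs b x z := by
  have := isProbabilityMeasure_expMeasure one_pos
  obtain ⟨hi, he⟩ := integral_lyapunov_flow (xs := xs) (b := b) hf hp.η_pos hp.θ_pos hθ1 x z
  -- The noise is integrated first, at fixed waiting time; the waiting time is then handled by
  -- integration by parts.
  rw [integral_prod _ hint, ← he]
  refine integral_mono_ae hint.integral_prod_left hi ?_
  filter_upwards [hint.prod_right_ae] with δ hδ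
  simp only [integral_const_mul]
  have hE := Real.exp_pos (θ * δ)
  gcongr
  refine (integral_lyapunov_jump_le hLS hg hp _ _ ?_).trans (lyapunov_sub_deriv_ge hp _ _ _)
  have := hδ.const_mul (Real.exp (θ * δ))⁻¹
  simpa [← mul_assoc, inv_mul_cancel₀ hE.ne'] using this

end OneStep

/-! ### The step as a map on states, with moment bounds and integrability. -/

/-- The state of the continuized method: the time, and the two iterates. -/
abbrev State (d : ℕ) : Type := ℝ × Vec d × Vec d

section Step

variable {d : ℕ} {Ξ : Type*}

/-- The point at which the gradient is evaluated, from a state and a waiting time. -/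
noncomputable def gradPoint (η η' : ℝ) (p : State d × (ℝ × Ξ)) : Vec d :=
  flowX η η' p.1.2.1 p.1.2.2 p.2.1

/-- One step of the continuized method, from a state, a waiting time and a noise. -/
noncomputable def stepMap (g : Vec d → Ξ → Vec d) (η η' γ γ' : ℝ) (p : State d × (ℝ × Ξ)) :
    State d :=
  (p.1.1 + p.2.1, gradPoint η η' p - γ • g (gradPoint η η' p) p.2.2,
    flowZ η η' p.1.2.1 p.1.2.2 p.2.1 - γ' • g (gradPoint η η' p) p.2.2)

/-- The Lyapunov function with its exponential weight. -/
noncomputable def weightedLyapunov (f : Vec d → ℝ) (xs : Vec d) (b θ : ℝ) (s : State d) : ℝ :=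
  Real.exp (θ * s.1) * lyapunov f xs b s.2.1 s.2.2

/-- The weighted squared distance to the minimizer. -/
noncomputable def weightedSqDist (xs : Vec d) (θ : ℝ) (s : State d) : ℝ :=
  Real.exp (θ * s.1) * (‖s.2.1 - xs‖ ^ 2 + ‖s.2.2 - xs‖ ^ 2)

/-- The weighted deficit in the aiming condition during a step. -/
noncomputable def weightedDeficit (g : Vec d → Ξ → Vec d) (xs : Vec d) (a η η' θ : ℝ)
    (p : State d × (ℝ × Ξ)) : ℝ :=
  Real.exp (θ * (p.1.1 + p.2.1)) * aimingDeficit g xs a (gradPoint η η' p) p.2.2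

/-- The weighted quantity that dominates all that happens during a step. -/
noncomputable def stepBound (g : Vec d → Ξ → Vec d) (xs : Vec d) (η η' θ : ℝ)
    (p : State d × (ℝ × Ξ)) : ℝ :=
  Real.exp (θ * (p.1.1 + p.2.1)) * (‖g (gradPoint η η' p) p.2.2‖ ^ 2 +
    (‖p.1.2.1 - xs‖ ^ 2 + ‖p.1.2.2 - xs‖ ^ 2))

variable {f : Vec d → ℝ} {xs : Vec d} {g : Vec d → Ξ → Vec d} {L ρ a θ η γ γ' b : ℝ}

theorem norm_sub_smul_sub_sq_le (v w : Vec d) (c : ℝ) :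
    ‖v - c • w - xs‖ ^ 2 ≤ 2 * ‖v - xs‖ ^ 2 + 2 * c ^ 2 * ‖w‖ ^ 2 := by
  have h : ‖v - c • w - xs‖ ≤ ‖v - xs‖ + |c| * ‖w‖ := by
    rw [show v - c • w - xs = (v - xs) - c • w by abel]
    refine (norm_sub_le _ _).trans_eq ?_
    rw [norm_smul, Real.norm_eq_abs]
  calc _ ≤ (‖v - xs‖ + |c| * ‖w‖) ^ 2 := by gcongr
    _ ≤ 2 * ‖v - xs‖ ^ 2 + 2 * |c| ^ 2 * ‖w‖ ^ 2 := by
        nlinarith [sq_nonneg (‖v - xs‖ - |c| * ‖w‖)]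
    _ = _ := by rw [sq_abs]

/-- Each component costs twice the old squared distances plus 2γ² or 2γ'² times ‖g‖². -/
theorem weightedSqDist_stepMap_le (hη : 0 < η) (hθ : 0 < θ) {p : State d × (ℝ × Ξ)}
    (hδ : 0 ≤ p.2.1) : weightedSqDist xs θ (stepMap g η θ γ γ' p) ≤
      (4 + 2 * γ ^ 2 + 2 * γ' ^ 2) * stepBound g xs η θ θ p := by
  have h1 := norm_sub_smul_sub_sq_le (xs := xs) (gradPoint η θ p) (g (gradPoint η θ p) p.2.2) γ
  have h2 := norm_sub_smul_sub_sq_le (xs := xs) (flowZ η θ p.1.2.1 p.1.2.2 p.2.1)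
    (g (gradPoint η θ p) p.2.2) γ'
  have h3 : ‖gradPoint η θ p - xs‖ ^ 2 ≤ _ := norm_flowX_sub_sq_le hη hθ p.1.2.1 p.1.2.2 xs hδ
  have h4 := norm_flowZ_sub_sq_le hη hθ p.1.2.1 p.1.2.2 xs hδ
  unfold weightedSqDist stepBound stepMap
  rw [mul_left_comm]
  have hE := Real.exp_nonneg (θ * (p.1.1 + p.2.1))
  gcongr
  set G := ‖g (gradPoint η θ p) p.2.2‖ ^ 2
  set n := ‖p.1.2.1 - xs‖ ^ 2 + ‖p.1.2.2 - xs‖ ^ 2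
  have hn : 0 ≤ n := by positivity
  have hG : 0 ≤ G := by positivity
  have : 0 ≤ (2 * γ ^ 2 + 2 * γ' ^ 2) * n + 4 * G := by positivity
  simp only
  linarith

theorem norm_weightedDeficit_le (hη : 0 < η) (hθ : 0 < θ) (ha : 0 < a) {p : State d × (ℝ × Ξ)}
    (hδ : 0 ≤ p.2.1) : ‖weightedDeficit g xs a η θ θ p‖ ≤
      (a + 1) * stepBound g xs η θ θ p := by
  have h3 : ‖gradPoint η θ p - xs‖ ^ 2 ≤ _ := norm_flowX_sub_sq_le hη hθ p.1.2.1 p.1.2.2 xs hδ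
  unfold weightedDeficit stepBound
  rw [mul_left_comm, norm_mul, Real.norm_of_nonneg (Real.exp_nonneg _)]
  gcongr
  set v := g (gradPoint η θ p) p.2.2
  set y := gradPoint η θ p
  have h5 : |⟪v, y - xs⟫| ≤ ‖v‖ * ‖y - xs‖ := abs_real_inner_le_norm _ _
  have h6 : ‖v‖ * ‖y - xs‖ ≤ ‖v‖ ^ 2 + ‖y - xs‖ ^ 2 := by
    nlinarith [sq_nonneg (‖v‖ - ‖y - xs‖), norm_nonneg v, norm_nonneg (y - xs)]
  have h7 : ‖aimingDeficit g xs a y p.2.2‖ ≤ (a + 1) * (‖v‖ * ‖y - xs‖) := by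
    rw [aimingDeficit, Real.norm_eq_abs, norm_sub_rev xs]
    refine (abs_sub _ _).trans ?_
    rw [abs_of_nonneg (by positivity : 0 ≤ a * ‖g y p.2.2‖ * ‖y - xs‖)]
    linarith
  refine h7.trans ?_
  gcongr
  linarith

theorem norm_weightedLyapunov_le (hLS : IsLSmooth L f) (hxs : IsUniqueMinimizer f xs)
    (hb : 0 < b) (s : State d) :
    ‖weightedLyapunov f xs b θ s‖ ≤ (L + b) * weightedSqDist xs θ s := by
  have hL := hLS.1
  have h := (hLS.qgUpper hxs).2 s.2.1
  have h0 := hxs.1 s.2.1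
  unfold weightedLyapunov weightedSqDist lyapunov
  rw [mul_left_comm, norm_mul, Real.norm_of_nonneg (Real.exp_nonneg _)]
  gcongr
  have hz : 0 ≤ b / 2 * ‖s.2.2 - xs‖ ^ 2 := by positivity
  rw [Real.norm_of_nonneg (by linarith)]
  have h1 : 0 ≤ L * ‖s.2.1 - xs‖ ^ 2 := by positivity
  have h2 : 0 ≤ L * ‖s.2.2 - xs‖ ^ 2 := by positivity
  have h3 : 0 ≤ b * ‖s.2.1 - xs‖ ^ 2 := by positivity
  linarith

theorem weightedLyapunov_nonneg (hxs : IsUniqueMinimizer f xs) (hb : 0 < b) (s : State d) :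
    0 ≤ weightedLyapunov f xs b θ s := by
  have h0 := sub_nonneg.2 (hxs.1 s.2.1)
  unfold weightedLyapunov lyapunov
  positivity

/-- The weight of the elapsed time factors out, which reduces a step from a random state to
`integral_lyapunov_step_le`. -/
theorem weightedLyapunov_stepMap_sub (p : State d × (ℝ × Ξ)) :
    weightedLyapunov f xs b θ (stepMap g η θ γ γ' p) - η * weightedDeficit g xs a η θ θ p =
      Real.exp (θ * p.1.1) * (Real.exp (θ * p.2.1) *
        (lyapunov f xs b (flowX η θ p.1.2.1 p.1.2.2 p.2.1 -
            γ • g (flowX η θ p.1.2.1 p.1.2.2 p.2.1) p.2.2)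
          (flowZ η θ p.1.2.1 p.1.2.2 p.2.1 - γ' • g (flowX η θ p.1.2.1 p.1.2.2 p.2.1) p.2.2)
          - η * aimingDeficit g xs a (flowX η θ p.1.2.1 p.1.2.2 p.2.1) p.2.2)) := by
  simp only [weightedLyapunov, weightedDeficit, stepMap, gradPoint, mul_add, Real.exp_add]
  ring

section Measure

variable [MeasurableSpace Ξ]

@[fun_prop]
theorem measurable_contAlpha (η η' : ℝ) : Measurable (contAlpha η η') := by
  unfold contAlpha; fun_prop

@[fun_prop]
theorem measurable_contBeta (η η' : ℝ) : Measurable (contBeta η η') := by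
  unfold contBeta; fun_prop

theorem measurable_gradPoint (η η' : ℝ) :
    Measurable (gradPoint η η' : State d × (ℝ × Ξ) → Vec d) := by
  unfold gradPoint flowX; fun_prop

theorem measurable_grad (hg : Measurable (Function.uncurry g)) (η η' : ℝ) :
    Measurable fun p : State d × (ℝ × Ξ) => g (gradPoint η η' p) p.2.2 :=
  hg.comp ((measurable_gradPoint η η').prodMk (by fun_prop))

theorem measurable_stepMap (hg : Measurable (Function.uncurry g)) (η η' γ γ' : ℝ) :
    Measurable (stepMap g η η' γ γ') := by
  have h1 := measurable_gradPoint (d := d) (Ξ := Ξ) η η'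
  have h2 := measurable_grad hg η η'
  unfold stepMap flowZ
  refine Measurable.prodMk (by fun_prop) (Measurable.prodMk (by fun_prop) ?_)
  have h3 : Measurable fun p : State d × (ℝ × Ξ) => flowX η η' p.1.2.1 p.1.2.2 p.2.1 := h1
  fun_prop

theorem measurable_weightedLyapunov (hf : ContDiff ℝ 1 f) :
    Measurable (weightedLyapunov f xs b θ) := by
  have := hf.continuous.measurable
  unfold weightedLyapunov lyapunov
  fun_prop

theorem measurable_weightedDeficit (hg : Measurable (Function.uncurry g)) :
    Measurable (weightedDeficit g xs a η θ θ) := by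
  have h1 := measurable_gradPoint (d := d) (Ξ := Ξ) η θ
  have h2 := measurable_grad hg η θ
  unfold weightedDeficit aimingDeficit
  fun_prop

theorem measurable_stepBound (hg : Measurable (Function.uncurry g)) :
    Measurable (stepBound g xs η θ θ) := by
  have h1 := measurable_gradPoint (d := d) (Ξ := Ξ) η θ
  have h2 := measurable_grad hg η θ
  unfold stepBound
  fun_prop

variable {Q : Measure Ξ} [IsProbabilityMeasure Q]

omit [IsProbabilityMeasure Q] in
theorem StrongGrowth.integral_norm_sq_le (hg : StrongGrowth f g Q ρ) (hLS : IsLSmooth L f)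
    (hxs : IsUniqueMinimizer f xs) (y : Vec d) :
    ∫ s, ‖g y s‖ ^ 2 ∂Q ≤ ρ * L ^ 2 * ‖y - xs‖ ^ 2 := by
  have hL := hLS.1
  have hρ := hg.one_le
  have h1 := hLS.norm_gradient_sq_le hxs y
  have h2 := (hLS.qgUpper hxs).2 y
  have h3 : 2 * L * (f y - f xs) ≤ L ^ 2 * ‖y - xs‖ ^ 2 := by
    calc _ ≤ 2 * L * (L / 2 * ‖y - xs‖ ^ 2) := by gcongr
      _ = _ := by ring
  calc _ ≤ ρ * ‖∇ f y‖ ^ 2 := hg.growth y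
    _ ≤ ρ * (L ^ 2 * ‖y - xs‖ ^ 2) := by gcongr; exact h1.trans h3
    _ = _ := by ring

/-- The bound is linear in the weighted squared distance of the state, so a finite moment propagates
from one step to the next. The factor (1 − θ)⁻¹ is E[e^{θδ}]. -/
theorem integrable_stepBound_fixed (hg : StrongGrowth f g Q ρ) (hLS : IsLSmooth L f)
    (hxs : IsUniqueMinimizer f xs) (hη : 0 < η) (hθ : 0 < θ) (hθ1 : θ < 1) (s : State d) :
    Integrable (fun u => stepBound g xs η θ θ (s, u)) ((expMeasure 1).prod Q) ∧
    ∫ u, stepBound g xs η θ θ (s, u) ∂((expMeasure 1).prod Q) ≤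
      (ρ * L ^ 2 + 1) * (1 - θ)⁻¹ * weightedSqDist xs θ s := by
  have := isProbabilityMeasure_expMeasure one_pos
  set n := ‖s.2.1 - xs‖ ^ 2 + ‖s.2.2 - xs‖ ^ 2 with hn
  have hm : AEStronglyMeasurable (fun u => stepBound g xs η θ θ (s, u))
      ((expMeasure 1).prod Q) :=
    ((measurable_stepBound hg.measurable).comp measurable_prodMk_left).aestronglyMeasurable
  have hslice : ∀ δ, Integrable (fun ζ => stepBound g xs η θ θ (s, (δ, ζ))) Q := fun δ =>
    ((hg.integrable_norm_sq (flowX η θ s.2.1 s.2.2 δ)).add (integrable_const n)).const_mul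
      (Real.exp (θ * (s.1 + δ)))
  have hnn : ∀ p, 0 ≤ stepBound g xs η θ θ p := fun p => by unfold stepBound; positivity
  have hval : ∀ δ, 0 ≤ δ → ∫ ζ, stepBound g xs η θ θ (s, (δ, ζ)) ∂Q ≤
      Real.exp (θ * δ) * ((ρ * L ^ 2 + 1) * weightedSqDist xs θ s) := by
    intro δ hδ
    have hρ := hg.one_le
    have h1 := hg.integral_norm_sq_le hLS hxs (flowX η θ s.2.1 s.2.2 δ)
    have h2 := norm_flowX_sub_sq_le hη hθ s.2.1 s.2.2 xs hδ
    simp only [stepBound, gradPoint, ← hn]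
    rw [integral_const_mul, integral_add (hg.integrable_norm_sq _) (integrable_const n)]
    simp only [integral_const, probReal_univ, one_smul, weightedSqDist, ← hn, mul_add θ,
      Real.exp_add]
    calc _ ≤ Real.exp (θ * s.1) * Real.exp (θ * δ) * (ρ * L ^ 2 * n + n) := by
            gcongr
            refine h1.trans ?_
            gcongr
      _ = _ := by ring
  have hi2 : Integrable (fun δ => Real.exp (θ * δ) *
      ((ρ * L ^ 2 + 1) * weightedSqDist xs θ s)) (expMeasure 1) :=
    (integrable_exp_mul_expMeasure_one hθ1).mul_const _
  have hint : Integrable (fun u => stepBound g xs η θ θ (s, u)) ((expMeasure 1).prod Q) := by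
    rw [integrable_prod_iff hm]
    refine ⟨Eventually.of_forall hslice, hi2.mono' hm.norm.integral_prod_right' ?_⟩
    filter_upwards [ae_expMeasure_one_pos] with δ hδ
    rw [Real.norm_of_nonneg (integral_nonneg fun _ => norm_nonneg _)]
    simp only [Real.norm_of_nonneg (hnn _)]
    exact hval δ hδ.le
  refine ⟨hint, ?_⟩
  rw [integral_prod _ hint]
  refine (integral_mono_ae hint.integral_prod_left hi2 ?_).trans_eq ?_
  · filter_upwards [ae_expMeasure_one_pos] with δ hδ using hval δ hδ.le
  · rw [integral_mul_const, integral_exp_mul_expMeasure_one hθ1]; ring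

theorem integrable_stepBound (hg : StrongGrowth f g Q ρ) (hLS : IsLSmooth L f)
    (hxs : IsUniqueMinimizer f xs) (hη : 0 < η) (hθ : 0 < θ) (hθ1 : θ < 1)
    {ν : Measure (State d)} [IsProbabilityMeasure ν] (hν : Integrable (weightedSqDist xs θ) ν) :
    Integrable (stepBound g xs η θ θ) (ν.prod ((expMeasure 1).prod Q)) := by
  have := isProbabilityMeasure_expMeasure one_pos
  have hm : AEStronglyMeasurable (stepBound g xs η θ θ) (ν.prod ((expMeasure 1).prod Q)) :=
    (measurable_stepBound hg.measurable).aestronglyMeasurable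
  have hnn : ∀ p, 0 ≤ stepBound g xs η θ θ p := fun p => by unfold stepBound; positivity
  rw [integrable_prod_iff hm]
  refine ⟨Eventually.of_forall fun s =>
    (integrable_stepBound_fixed hg hLS hxs hη hθ hθ1 s).1,
    (hν.const_mul ((ρ * L ^ 2 + 1) * (1 - θ)⁻¹)).mono' hm.norm.integral_prod_right'
      (Eventually.of_forall fun s => ?_)⟩
  rw [Real.norm_of_nonneg (integral_nonneg fun _ => norm_nonneg _)]
  simp only [Real.norm_of_nonneg (hnn _)]
  exact (integrable_stepBound_fixed hg hLS hxs hη hθ hθ1 s).2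

/-- The effect of one step on the expected Lyapunov function, for a random state. -/
theorem expected_step (hf : ContDiff ℝ 1 f) (hLS : IsLSmooth L f) (hxs : IsUniqueMinimizer f xs)
    (hg : StrongGrowth f g Q ρ) (hp : LyapunovParams f xs L ρ a θ η γ γ' b) (hθ1 : θ < 1)
    {ν : Measure (State d)} [IsProbabilityMeasure ν] (hν : Integrable (weightedSqDist xs θ) ν) :
    Integrable (fun p => weightedSqDist xs θ (stepMap g η θ γ γ' p))
      (ν.prod ((expMeasure 1).prod Q)) ∧
    Integrable (fun p => weightedLyapunov f xs b θ (stepMap g η θ γ γ' p))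
      (ν.prod ((expMeasure 1).prod Q)) ∧
    Integrable (weightedDeficit g xs a η θ θ) (ν.prod ((expMeasure 1).prod Q)) ∧
    ∫ p, weightedLyapunov f xs b θ (stepMap g η θ γ γ' p) ∂(ν.prod ((expMeasure 1).prod Q)) ≤
      ∫ s, weightedLyapunov f xs b θ s ∂ν +
      η * ∫ p, weightedDeficit g xs a η θ θ p ∂(ν.prod ((expMeasure 1).prod Q)) := by
  have := isProbabilityMeasure_expMeasure one_pos
  have hη := hp.η_pos
  have hθ := hp.θ_pos
  have hB := integrable_stepBound hg hLS hxs hη hθ hθ1 hν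
  have hms := measurable_stepMap hg.measurable η θ γ γ'
  have hpos : ∀ᵐ p : State d × (ℝ × Ξ) ∂(ν.prod ((expMeasure 1).prod Q)), 0 < p.2.1 :=
    Measure.quasiMeasurePreserving_snd.ae
      (Measure.quasiMeasurePreserving_fst.ae ae_expMeasure_one_pos)
  have hmd : Measurable (weightedSqDist xs θ) := by unfold weightedSqDist; fun_prop
  have hN : Integrable (fun p => weightedSqDist xs θ (stepMap g η θ γ γ' p))
      (ν.prod ((expMeasure 1).prod Q)) := by
    refine (hB.const_mul (4 + 2 * γ ^ 2 + 2 * γ' ^ 2)).mono'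
      (hmd.comp hms).aestronglyMeasurable ?_
    filter_upwards [hpos] with p hδ
    rw [Real.norm_of_nonneg (by unfold weightedSqDist; positivity)]
    exact weightedSqDist_stepMap_le hη hθ hδ.le
  have hV : Integrable (fun p => weightedLyapunov f xs b θ (stepMap g η θ γ γ' p))
      (ν.prod ((expMeasure 1).prod Q)) :=
    (hN.const_mul (L + b)).mono'
      ((measurable_weightedLyapunov hf).comp hms).aestronglyMeasurable
      (Eventually.of_forall fun p => norm_weightedLyapunov_le hLS hxs hp.b_pos _)
  have hD : Integrable (weightedDeficit g xs a η θ θ) (ν.prod ((expMeasure 1).prod Q)) := by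
    refine (hB.const_mul (a + 1)).mono'
      (measurable_weightedDeficit hg.measurable).aestronglyMeasurable ?_
    filter_upwards [hpos] with p hδ using norm_weightedDeficit_le hη hθ hp.a_pos hδ.le
  refine ⟨hN, hV, hD, ?_⟩
  have hV0 : Integrable (weightedLyapunov f xs b θ) ν :=
    (hν.const_mul (L + b)).mono' (measurable_weightedLyapunov hf).aestronglyMeasurable
      (Eventually.of_forall fun p => norm_weightedLyapunov_le hLS hxs hp.b_pos _)
  have hVD := hV.sub (hD.const_mul η)
  rw [← sub_le_iff_le_add, ← integral_const_mul, ← integral_sub hV (hD.const_mul η)]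
  change Integrable (fun p => weightedLyapunov f xs b θ (stepMap g η θ γ γ' p) -
    η * weightedDeficit g xs a η θ θ p) _ at hVD
  rw [integral_prod _ hVD]
  refine integral_mono_ae hVD.integral_prod_left hV0 ?_
  filter_upwards [hVD.prod_right_ae] with s hs
  simp only [weightedLyapunov_stepMap_sub] at hs ⊢
  rw [integral_const_mul, weightedLyapunov]
  gcongr
  refine integral_lyapunov_step_le hf hLS hg hp hθ1 _ _ ?_
  have := hs.const_mul (Real.exp (θ * s.1))⁻¹
  simpa [← mul_assoc, inv_mul_cancel₀ (Real.exp_pos _).ne'] using this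

end Measure

end Step

/-! ### Independence of the current state and the next input. -/

section Chain

variable {Ω E U : Type*} [MeasurableSpace Ω] [MeasurableSpace E] [MeasurableSpace U]
  {P : Measure Ω} [IsProbabilityMeasure P]

/-- A state computed from the past by measurable updates is independent of the present input. -/
theorem hasLaw_state_prod {π : Measure U} [IsProbabilityMeasure π] {u : ℕ → Ω → U}
    (hlaw : ∀ k, HasLaw (u k) π P)
    (hind : iIndepFun u P) {Φ : E × U → E} (hΦ : Measurable Φ) {S : ℕ → Ω → E} {s₀ : E}
    (h0 : ∀ ω, S 0 ω = s₀) (hS : ∀ k ω, S (k + 1) ω = Φ (S k ω, u k ω)) (k : ℕ) :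
    AEMeasurable (S k) P ∧ HasLaw (fun ω => (S k ω, u k ω)) ((P.map (S k)).prod π) P := by
  have hu : ∀ k, AEMeasurable (u k) P := fun k => (hlaw k).aemeasurable
  -- The state is a measurable function of the first k inputs alone, so independence of disjoint
  -- blocks of inputs applies.
  have hM : ∀ k, ∃ M : (Finset.range k → U) → E, Measurable M ∧
      ∀ ω, S k ω = M fun i => u i ω := by
    intro k
    induction k with
    | zero => exact ⟨fun _ => s₀, measurable_const, h0⟩
    | succ k ih =>
      obtain ⟨M, hM, hMS⟩ := ih
      refine ⟨fun v => Φ (M fun i => v ⟨i, Finset.mem_range.2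
        ((Finset.mem_range.1 i.2).trans (Nat.lt_succ_self k))⟩,
        v ⟨k, Finset.self_mem_range_succ k⟩), ?_, fun ω => by rw [hS, hMS]⟩
      fun_prop
  obtain ⟨M, hM, hMS⟩ := hM k
  have hSk : AEMeasurable (S k) P := by
    rw [show S k = M ∘ fun ω (i : Finset.range k) => u i ω from funext hMS]
    exact hM.comp_aemeasurable (aemeasurable_pi_lambda _ fun i => hu i)
  have hindep : IndepFun (S k) (u k) P := by
    have h := hind.indepFun_finset₀ (Finset.range k) {k} (by simp) hu
    have h2 := h.comp hM (measurable_pi_apply (⟨k, Finset.mem_singleton_self k⟩ :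
      ({k} : Finset ℕ)))
    rwa [show S k = M ∘ fun ω (i : Finset.range k) => u i ω from funext hMS]
  refine ⟨hSk, hSk.prodMk (hu k), ?_⟩
  rw [(indepFun_iff_map_prod_eq_prod_map_map hSk (hu k)).1 hindep, (hlaw k).map_eq]

end Chain

/-! ### Expected Lyapunov function along the chain, and the tail of the clock. -/

section Expectation

variable {d : ℕ} {Ω Ξ : Type*} [MeasurableSpace Ω] [MeasurableSpace Ξ] {P : Measure Ω}
  [IsProbabilityMeasure P] {Q : Measure Ξ} [IsProbabilityMeasure Q]
  {f : Vec d → ℝ} {xs : Vec d} {g : Vec d → Ξ → Vec d} {L ρ a θ η γ γ' b : ℝ}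

/-- The expected weighted Lyapunov function is controlled by the accumulated aiming deficit. -/
theorem expected_lyapunov_le (hf : ContDiff ℝ 1 f) (hLS : IsLSmooth L f)
    (hxs : IsUniqueMinimizer f xs)
    (hg : StrongGrowth f g Q ρ) (hp : LyapunovParams f xs L ρ a θ η γ γ' b) (hθ1 : θ < 1)
    {u : ℕ → Ω → ℝ × Ξ} (hlaw : ∀ k, HasLaw (u k) ((expMeasure 1).prod Q) P)
    (hind : iIndepFun u P) {S : ℕ → Ω → State d} {s₀ : State d} (h0 : ∀ ω, S 0 ω = s₀)
    (hS : ∀ k ω, S (k + 1) ω = stepMap g η θ γ γ' (S k ω, u k ω)) (k : ℕ)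
    (hAim : ∀ᵐ ω ∂P, ∑ j ∈ Finset.range k, weightedDeficit g xs a η θ θ (S j ω, u j ω) ≤ 0) :
    Integrable (fun ω => weightedLyapunov f xs b θ (S k ω)) P ∧
    ∫ ω, weightedLyapunov f xs b θ (S k ω) ∂P ≤ weightedLyapunov f xs b θ s₀ := by
  have := isProbabilityMeasure_expMeasure one_pos
  have hms := measurable_stepMap hg.measurable η θ γ γ'
  have hmd : Measurable (weightedSqDist xs θ) := by unfold weightedSqDist; fun_prop
  have hchain := hasLaw_state_prod hlaw hind hms h0 hS
  have hmD := measurable_weightedDeficit (xs := xs) (a := a) (η := η) (θ := θ) hg.measurable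
  have hmV := measurable_weightedLyapunov (xs := xs) (b := b) (θ := θ) hf
  -- The squared distance is carried along because its integrability is what feeds the next step.
  -- The deficits stay as a sum, since individually they have no sign.
  have main : ∀ n, Integrable (fun ω => weightedSqDist xs θ (S n ω)) P ∧
      (∀ j < n, Integrable (fun ω => weightedDeficit g xs a η θ θ (S j ω, u j ω)) P) ∧
      ∫ ω, weightedLyapunov f xs b θ (S n ω) ∂P ≤ weightedLyapunov f xs b θ s₀ +
        η * ∑ j ∈ Finset.range n, ∫ ω, weightedDeficit g xs a η θ θ (S j ω, u j ω) ∂P := by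
    intro n
    induction n with
    | zero => simp [h0]
    | succ n ih =>
      obtain ⟨ih1, ih2, ih3⟩ := ih
      obtain ⟨hSm, hSl⟩ := hchain n
      have := Measure.isProbabilityMeasure_map hSm
      obtain ⟨e1, e2, e3, e4⟩ := expected_step hf hLS hxs hg hp hθ1 (ν := P.map (S n))
        ((integrable_map_measure hmd.aestronglyMeasurable hSm).2 ih1)
      have t1 := hSl.map_eq ▸ e1
      have t3 := hSl.map_eq ▸ e3
      replace t1 := (integrable_map_measure (hmd.comp hms).aestronglyMeasurable
        hSl.aemeasurable).1 t1
      replace t3 := (integrable_map_measure hmD.aestronglyMeasurable hSl.aemeasurable).1 t3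
      refine ⟨by simpa [hS, Function.comp_def] using t1, fun j hj => ?_, ?_⟩
      · rcases Nat.lt_succ_iff_lt_or_eq.1 hj with h | rfl
        · exact ih2 j h
        · exact t3
      · have i1 := hSl.integral_comp (hmV.comp hms).aestronglyMeasurable
        have i2 := hSl.integral_comp hmD.aestronglyMeasurable
        simp only [Function.comp_def] at i1 i2
        rw [← i1, ← i2, integral_map hSm hmV.aestronglyMeasurable] at e4
        rw [Finset.sum_range_succ, mul_add]
        simp only [hS]
        linarith
  obtain ⟨m1, m2, m3⟩ := main k
  refine ⟨(m1.const_mul (L + b)).mono' (hmV.comp_aemeasurable (hchain k).1).aestronglyMeasurable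
      (Eventually.of_forall fun p => norm_weightedLyapunov_le hLS hxs hp.b_pos _), ?_⟩
  -- Only the complete sum is nonpositive, so it is reassembled under the integral.
  rw [← integral_finsetSum _ fun j hj => m2 j (Finset.mem_range.1 hj)] at m3
  have := integral_nonpos_of_ae hAim
  nlinarith [hp.η_pos]

/-- Chernoff bound for the lower tail of the arrival times of the Poisson clock. -/
theorem IsMarkedPoissonClock.lower_tail {T : ℕ → Ω → ℝ} {ξ : ℕ → Ω → Ξ}
    (h : IsMarkedPoissonClock P Q T ξ) (k : ℕ) {c : ℝ} (hc : c ∈ Ioo (0 : ℝ) 1) :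
    P.real {ω | T k ω ≤ (1 - c) * k} ≤
      Real.exp (-((1 - c) - 1 - Real.log (1 - c)) * k) := by
  have hπ := isProbabilityMeasure_expMeasure one_pos
  have hc1 : 0 < 1 - c := by linarith [hc.2]
  set X : ℕ → Ω → ℝ := fun j ω => T (j + 1) ω - T j ω with hX
  have hXlaw : ∀ j, HasLaw (X j) (expMeasure 1) P := fun j => by
    have h1 : HasLaw Prod.fst (expMeasure 1) ((expMeasure 1).prod Q) :=
      (measurePreserving_fst).hasLaw
    exact h1.fun_comp (h.law j)
  have hXind : iIndepFun X P := h.indep.comp (fun _ => Prod.fst) fun _ => measurable_fst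
  have hT : ∀ n, T n = ∑ j ∈ Finset.range n, X j := by
    intro n
    ext ω
    rw [Finset.sum_apply, Finset.sum_range_sub (fun j => T j ω), h.zero, sub_zero]
  -- The minimizer of −t(1 − c) − log(1 − t), that is, 1 − t = 1/(1 − c).
  set t : ℝ := -(c / (1 - c)) with ht
  have ht0 : t ≤ 0 := by rw [ht, neg_nonpos]; exact div_nonneg hc.1.le hc1.le
  have hmgf : mgf (T k) P t = (1 - c) ^ k := by
    rw [hT, hXind.mgf_sum₀ fun j => (hXlaw j).aemeasurable]
    have : ∀ j, mgf (X j) P t = 1 - c := fun j => by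
      have h1 := (hXlaw j).integral_comp (f := fun s => Real.exp (t * s))
        (by fun_prop)
      rw [integral_exp_mul_expMeasure_one (by linarith)] at h1
      rw [mgf]
      refine h1.trans ?_
      rw [ht]; field_simp; ring
    simp [this]
  have hint : Integrable (fun ω => Real.exp (t * T k ω)) P := by
    -- A non-integrable exponential would have integral 0 by convention, against the positive value
    -- just computed.
    by_contra hn
    have := integral_undef hn
    rw [mgf] at hmgf
    exact (pow_pos hc1 k).ne' (hmgf ▸ this)
  refine (measure_le_le_exp_mul_mgf _ ht0 hint).trans_eq ?_
  rw [hmgf]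
  have : (1 - c) ^ k = Real.exp (Real.log (1 - c) * k) := by
    rw [mul_comm, Real.exp_nat_mul, Real.exp_log hc1]
  rw [this, ← Real.exp_add]
  congr 1
  rw [ht]; field_simp; ring

end Expectation

/-! ### Verification of the parameters, and size of the rate. -/

section Parameters

variable {d : ℕ} {f : Vec d → ℝ} {xs : Vec d} {μ L μ₀ L₀ a ρ θ η γ γ' : ℝ}

/-- The parameters of the continuized method make the Lyapunov function decrease. -/
theorem lyapunovParams_of_sharp_constants (hPL : IsPL μ f xs) (hLS : IsLSmooth L f)
    (hlow : QGLower μ₀ f xs) (hup : QGUpper L₀ f xs) (hρ : 1 ≤ ρ) (ha : 0 < a)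
    (hθ : θ = a / ρ * (μ₀ / L₀) ^ (1 / 4 : ℝ) * √(μ / L))
    (hγ : γ = 1 / (ρ * L))
    (hγ' : γ' = 1 / (ρ * (μ₀ * L₀) ^ (1 / 4 : ℝ) * √L))
    (hη : η = 1 / ρ * ((μ₀ * L₀) ^ (1 / 4 : ℝ) / √L)) :
    LyapunovParams f xs L ρ a θ η γ γ' (μ₀ * √(L₀ / μ₀)) := by
  have hμ := hPL.1
  have hL := hLS.1
  have hμ₀ := hlow.1
  have hL₀ := hup.1
  have hρ0 : 0 < ρ := by linarith
  -- Fourth roots of μ₀, L₀ and square roots of μ, L make every parameter rational; b becomes u²v².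
  obtain ⟨u, hu, hu4⟩ : ∃ u : ℝ, 0 < u ∧ μ₀ = u ^ 4 :=
    ⟨μ₀ ^ (1 / 4 : ℝ), by positivity, by
      rw [← Real.rpow_natCast, ← Real.rpow_mul hμ₀.le]; norm_num⟩
  obtain ⟨v, hv, hv4⟩ : ∃ v : ℝ, 0 < v ∧ L₀ = v ^ 4 :=
    ⟨L₀ ^ (1 / 4 : ℝ), by positivity, by
      rw [← Real.rpow_natCast, ← Real.rpow_mul hL₀.le]; norm_num⟩
  obtain ⟨m, hm, hm2⟩ : ∃ m : ℝ, 0 < m ∧ μ = m ^ 2 :=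
    ⟨√μ, Real.sqrt_pos.2 hμ, (Real.sq_sqrt hμ.le).symm⟩
  obtain ⟨l, hl, hl2⟩ : ∃ l : ℝ, 0 < l ∧ L = l ^ 2 :=
    ⟨√L, Real.sqrt_pos.2 hL, (Real.sq_sqrt hL.le).symm⟩
  have r4 : ∀ w : ℝ, 0 < w → (w ^ 4) ^ (1 / 4 : ℝ) = w := fun w hw => by
    rw [← Real.rpow_natCast, ← Real.rpow_mul hw.le]; norm_num
  have q1 : (μ₀ * L₀) ^ (1 / 4 : ℝ) = u * v := by
    rw [hu4, hv4, ← mul_pow, r4 _ (by positivity)]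
  have q2 : (μ₀ / L₀) ^ (1 / 4 : ℝ) = u / v := by
    rw [hu4, hv4, ← div_pow, r4 _ (by positivity)]
  have q3 : √(L₀ / μ₀) = v ^ 2 / u ^ 2 := by
    rw [hu4, hv4, show v ^ 4 / u ^ 4 = (v ^ 2 / u ^ 2) ^ 2 by field_simp]
    exact Real.sqrt_sq (by positivity)
  have q4 : √(μ / L) = m / l := by
    rw [hm2, hl2, ← div_pow, Real.sqrt_sq (by positivity)]
  have q5 : √L = l := by rw [hl2, Real.sqrt_sq hl.le]
  have q6 : μ₀ * √(L₀ / μ₀) = u ^ 2 * v ^ 2 := by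
    rw [q3, hu4]; field_simp
  rw [q2, q4] at hθ
  rw [q1, q5] at hγ' hη
  rw [hl2] at hγ
  rw [q6]
  refine ⟨ha, by rw [hθ]; positivity, by rw [hη]; positivity, by positivity, ?_, ?_, fun x => ?_⟩
  · rw [hη, hγ']; field_simp
  -- The balance is an equality: both terms on the left equal 1/(2ρL).
  · rw [hγ', hγ, hl2]
    apply le_of_eq
    field_simp
    norm_num
  · have hη0 : 0 < η := by rw [hη]; positivity
    have hθ0 : 0 < θ := by rw [hθ]; positivity
    have hF0 : 0 ≤ f x - f xs := (by positivity : 0 ≤ μ₀ / 2 * ‖x - xs‖ ^ 2).trans (hlow.2 x)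
    have h1 := hlow.2 x
    have h2 := hup.2 x
    have h3 := hPL.2 x
    rw [norm_sub_rev xs]
    set r := ‖x - xs‖
    set G := ‖∇ f x‖
    have hr : 0 ≤ r := norm_nonneg _
    have hG : 0 ≤ G := norm_nonneg _
    obtain ⟨s, hs, hs2⟩ : ∃ s : ℝ, 0 ≤ s ∧ 2 * (f x - f xs) = s ^ 2 :=
      ⟨√(2 * (f x - f xs)), Real.sqrt_nonneg _, (Real.sq_sqrt (by linarith)).symm⟩
    have k1 : u ^ 2 * r ≤ s := by
      apply (abs_le_of_sq_le_sq' _ hs).2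
      rw [hu4] at h1
      rw [← hs2]; linarith
    have k2 : s ≤ v ^ 2 * r := by
      apply (abs_le_of_sq_le_sq' _ (by positivity)).2
      rw [hv4] at h2
      rw [← hs2]; linarith
    have k3 : m * s ≤ G := by
      apply (abs_le_of_sq_le_sq' _ hG).2
      rw [mul_pow, ← hs2, ← hm2]; linarith
    have k4 : θ * v ^ 2 = a * η * m := by
      rw [hθ, hη]; field_simp
    -- With s = √(2(f − f*)), upper growth replaces one s by v²r in the first term and lower growth
    -- replaces u²r by s in the second. Both become multiples of rs, and PL turns s into G.
    calc θ * (f x - f xs) + u ^ 2 * v ^ 2 * θ / 2 * r ^ 2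
        = θ / 2 * (s * s) + θ * v ^ 2 / 2 * r * (u ^ 2 * r) := by
          rw [← sq, ← hs2]; ring
      _ ≤ θ / 2 * (s * (v ^ 2 * r)) + θ * v ^ 2 / 2 * r * s := by gcongr
      _ = (θ * v ^ 2) * r * s := by ring
      _ = η * a * r * (m * s) := by rw [k4]; ring
      _ ≤ η * a * r * G := by gcongr
      _ = _ := by ring

/-- The rate is less than `1` except in a case where one step suffices. -/
theorem rate_lt_one_or (hμ : 0 < μ) (h1 : μ ≤ μ₀) (h2 : μ₀ ≤ L₀) (h3 : L₀ ≤ L) (hρ : 1 ≤ ρ)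
    (ha : 0 < a) (ha1 : a ≤ 1) (hθ : θ = a / ρ * (μ₀ / L₀) ^ (1 / 4 : ℝ) * √(μ / L)) :
    θ < 1 ∨ ρ = 1 ∧ μ = L := by
  have hμ₀ : 0 < μ₀ := by linarith
  have hL₀ : 0 < L₀ := by linarith
  have hL : 0 < L := by linarith
  have hρ0 : 0 < ρ := by linarith
  by_contra! hcon
  obtain ⟨hge, hne⟩ := hcon
  have e1 : a / ρ ≤ 1 := by rw [div_le_one hρ0]; linarith
  have e2 : (μ₀ / L₀) ^ (1 / 4 : ℝ) ≤ 1 :=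
    Real.rpow_le_one (by positivity) (by rw [div_le_one hL₀]; exact h2) (by norm_num)
  have e3 : √(μ / L) ≤ 1 := by
    rw [Real.sqrt_le_iff, one_pow, div_le_one hL]
    exact ⟨zero_le_one, by linarith⟩
  have p1 : 0 < a / ρ := by positivity
  have p2 : 0 < (μ₀ / L₀) ^ (1 / 4 : ℝ) := by positivity
  have p3 : 0 ≤ √(μ / L) := Real.sqrt_nonneg _
  have p12 : a / ρ * (μ₀ / L₀) ^ (1 / 4 : ℝ) ≤ a / ρ := mul_le_of_le_one_right p1.le e2
  have g1 : 1 ≤ a / ρ := by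
    rw [hθ] at hge
    exact hge.trans ((mul_le_of_le_one_right (by positivity) e3).trans p12)
  have g3 : 1 ≤ √(μ / L) := by
    rw [hθ] at hge
    exact hge.trans (mul_le_of_le_one_left p3 (p12.trans e1))
  rw [le_div_iff₀ hρ0] at g1
  rw [Real.one_le_sqrt, le_div_iff₀ hL] at g3
  exact hne (by linarith) (by linarith)

end Parameters

/-! ### Noise at the minimizer, and the case ρ = 1, μ = L. -/

section Degenerate

variable {d : ℕ} {Ξ : Type*} [MeasurableSpace Ξ] {Q : Measure Ξ} [IsProbabilityMeasure Q]
  {f : Vec d → ℝ} {xs : Vec d} {g : Vec d → Ξ → Vec d} {L ρ : ℝ}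

omit [IsProbabilityMeasure Q] in
theorem StrongGrowth.ae_eq_zero (hg : StrongGrowth f g Q ρ) (hxs : IsUniqueMinimizer f xs) :
    ∀ᵐ s ∂Q, g xs s = 0 := by
  have h := hg.growth xs
  rw [hxs.gradient_eq_zero, norm_zero, zero_pow two_ne_zero, mul_zero] at h
  have h0 := h.antisymm (integral_nonneg fun s => sq_nonneg _)
  rw [integral_eq_zero_iff_of_nonneg (fun s => sq_nonneg _) (hg.integrable_norm_sq xs)] at h0
  filter_upwards [h0] with s hs
  simpa using hs

/-- If the condition number and the growth constant are `1`, a gradient step reaches the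
minimizer. -/
theorem ae_gradient_step_eq_min (hf : ContDiff ℝ 1 f) (hxs : IsUniqueMinimizer f xs)
    (hPL : IsPL L f xs) (hLS : IsLSmooth L f) (hg : StrongGrowth f g Q 1) (y : Vec d) :
    ∀ᵐ s ∂Q, f (y - (1 / L) • g y s) = f xs := by
  have hL := hLS.1
  have i1 : Integrable (fun s => f y - f xs - 1 / L * ⟪∇ f y, g y s⟫) Q :=
    (integrable_const _).sub (((hg.integrable y).const_inner (∇ f y)).const_mul _)
  have i2 := (hg.integrable_norm_sq y).const_mul (L / 2 * (1 / L) ^ 2)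
  have hle : ∀ s, f (y - (1 / L) • g y s) - f xs ≤ f y - f xs - 1 / L * ⟪∇ f y, g y s⟫ +
      L / 2 * (1 / L) ^ 2 * ‖g y s‖ ^ 2 := fun s => by
    linarith [hLS.sub_smul_le y (g y s) (1 / L)]
  have hnn : ∀ s, 0 ≤ f (y - (1 / L) • g y s) - f xs := fun s => sub_nonneg.2 (hxs.1 _)
  have hgm : Measurable (g y) := hg.measurable.comp measurable_prodMk_left
  have hfm := hf.continuous.measurable
  have hint : Integrable (fun s => f (y - (1 / L) • g y s) - f xs) Q := by
    refine (i1.add i2).mono' (Measurable.aestronglyMeasurable (by fun_prop))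
      (Eventually.of_forall fun s => ?_)
    rw [Real.norm_of_nonneg (hnn s)]
    exact hle s
  -- The mean gap after the step is at most f(y) − f* − ‖∇f(y)‖²/(2L), which PL with constant L
  -- makes nonpositive; a nonnegative gap of mean 0 vanishes almost surely.
  have h0 : ∫ s, (f (y - (1 / L) • g y s) - f xs) ∂Q ≤ 0 := by
    refine (integral_mono hint (i1.add i2) hle).trans ?_
    simp only [Pi.add_apply]
    rw [integral_add i1 i2, integral_const_mul, integral_sub (integrable_const _)
      (((hg.integrable y).const_inner (∇ f y)).const_mul _), integral_const_mul,
      integral_inner (hg.integrable y), hg.unbiased, real_inner_self_eq_norm_sq]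
    simp only [integral_const, probReal_univ, one_smul]
    have h1 := hg.growth y
    have h2 := hPL.2 y
    have h3 : L / 2 * (1 / L) ^ 2 * ∫ s, ‖g y s‖ ^ 2 ∂Q ≤
      L / 2 * (1 / L) ^ 2 * (1 * ‖∇ f y‖ ^ 2) := by gcongr
    have h4 : f y - f xs ≤ 1 / (2 * L) * ‖∇ f y‖ ^ 2 := by
      rw [one_div, inv_mul_eq_div, le_div_iff₀ (by positivity)]; linarith
    have h5 : f y - f xs - 1 / L * ‖∇ f y‖ ^ 2 + L / 2 * (1 / L) ^ 2 * (1 * ‖∇ f y‖ ^ 2) =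
        f y - f xs - 1 / (2 * L) * ‖∇ f y‖ ^ 2 := by field_simp; ring
    linarith
  have h1 := h0.antisymm (integral_nonneg hnn)
  rw [integral_eq_zero_iff_of_nonneg hnn hint] at h1
  filter_upwards [h1] with s hs
  exact sub_eq_zero.1 hs

end Degenerate

/-! ### The marks, and the exceptional starting points. -/

section Clock

variable {d : ℕ} {Ω Ξ : Type*} [MeasurableSpace Ω] [MeasurableSpace Ξ] {P : Measure Ω}
  {Q : Measure Ξ}
  {T : ℕ → Ω → ℝ} {ξ : ℕ → Ω → Ξ}

theorem IsMarkedPoissonClock.hasLaw_mark [IsProbabilityMeasure Q] (h : IsMarkedPoissonClock P Q T ξ) (k : ℕ) :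
    HasLaw (ξ k) Q P := by
  have := isProbabilityMeasure_expMeasure one_pos
  have h1 : HasLaw Prod.snd Q ((expMeasure 1).prod Q) := measurePreserving_snd.hasLaw
  exact h1.fun_comp (h.law k)

theorem ae_comp_of_hasLaw {E : Type*} [MeasurableSpace E] {X : Ω → E} {ν : Measure E}
    (hX : HasLaw X ν P) {p : E → Prop} (hp : ∀ᵐ e ∂ν, p e) : ∀ᵐ ω ∂P, p (X ω) :=
  ae_of_ae_map hX.aemeasurable (hX.map_eq.symm ▸ hp)

variable {f : Vec d → ℝ} {xs : Vec d} {g : Vec d → Ξ → Vec d} {L ρ a θ γ γ' : ℝ}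
  {x y z : ℕ → Ω → Vec d} {α β : Ω → ℕ → ℝ}

/-- Started at the minimizer, the method stays there. -/
theorem ae_eq_minimizer_of_start (hxs : IsUniqueMinimizer f xs) (hg : StrongGrowth f g Q ρ)
    (hξ : ∀ k, HasLaw (ξ k) Q P) (hx₀ : ∀ ω, x 0 ω = xs) (hz₀ : ∀ ω, z 0 ω = xs)
    (hNM : ∀ ω, IsNesterov (α ω) (β ω) γ γ' (fun k v => g v (ξ k ω)) (fun k => x k ω)
      (fun k => y k ω) (fun k => z k ω)) (k : ℕ) :
    ∀ᵐ ω ∂P, x k ω = xs := by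
  have h0 : ∀ᵐ ω ∂P, ∀ j, g xs (ξ j ω) = 0 :=
    ae_all_iff.2 fun j => ae_comp_of_hasLaw (hξ j) (hg.ae_eq_zero hxs)
  filter_upwards [h0] with ω hω
  have : ∀ j, x j ω = xs ∧ z j ω = xs := by
    intro j
    induction j with
    | zero => exact ⟨hx₀ ω, hz₀ ω⟩
    | succ j ih =>
      have hy : y j ω = xs := by
        have := (hNM ω).y_eq j
        simpa [ih.1, ih.2] using this
      have h1 := (hNM ω).x_succ j
      have h2 := (hNM ω).z_succ j
      simp only [hy, hω j, ih.2, smul_zero, sub_zero, sub_self, add_zero] at h1 h2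
      exact ⟨h1, h2⟩
  exact (this k).1

/-- An aiming condition with a constant larger than `1` holds only from the minimizer. -/
theorem start_eq_minimizer_of_one_lt (hxs : IsUniqueMinimizer f xs) {μ : ℝ} (hPL : IsPL μ f xs)
    (hg : StrongGrowth f g Q ρ) (hξ : ∀ k, HasLaw (ξ k) Q P) {x₀ : Vec d}
    (hx₀ : ∀ ω, x 0 ω = x₀) (hz₀ : ∀ ω, z 0 ω = x₀)
    (hNM : ∀ ω, IsNesterov (α ω) (β ω) γ γ' (fun k v => g v (ξ k ω)) (fun k => x k ω)
      (fun k => y k ω) (fun k => z k ω)) {k : ℕ} (hk : 0 < k) (ha : 1 < a)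
    (hAim : AveragedAiming P g xs a (fun i ω => Real.exp (θ * T i ω)) y ξ k) : x₀ = xs := by
  by_contra hne
  have hr : 0 < ‖xs - x₀‖ := norm_pos_iff.2 (sub_ne_zero.2 (Ne.symm hne))
  -- For a > 1 Cauchy–Schwarz makes every term of the sum nonpositive, so all vanish. The first is
  -- taken at the deterministic point x₀: there g = 0 almost surely, hence ∇f(x₀) = 0.
  have hbound : ∀ (v w : Vec d), ⟪v, w - xs⟫ - a * ‖v‖ * ‖xs - w‖ ≤
      -((a - 1) * (‖v‖ * ‖xs - w‖)) := fun v w => by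
    have := real_inner_le_norm v (w - xs)
    rw [norm_sub_rev w] at this
    linarith
  have h0 : ∀ᵐ ω ∂P, g x₀ (ξ 0 ω) = 0 := by
    filter_upwards [hAim] with ω hω
    have hy : y 0 ω = x₀ := by
      have := (hNM ω).y_eq 0
      simpa [hx₀, hz₀] using this
    have hneg : ∀ j ∈ Finset.range k, Real.exp (θ * T (j + 1) ω) *
        (⟪g (y j ω) (ξ j ω), y j ω - xs⟫ - a * ‖g (y j ω) (ξ j ω)‖ * ‖xs - y j ω‖) ≤ 0 := by
      intro j _
      refine mul_nonpos_of_nonneg_of_nonpos (Real.exp_nonneg _) ((hbound _ _).trans ?_)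
      have : 0 ≤ a - 1 := by linarith
      rw [neg_nonpos]; positivity
    have hz := (Finset.sum_eq_zero_iff_of_nonpos hneg).1
      (le_antisymm (Finset.sum_nonpos hneg) hω) 0 (Finset.mem_range.2 hk)
    rw [hy] at hz
    have h1 := (mul_eq_zero.1 hz).resolve_left (Real.exp_pos _).ne'
    have h2 := hbound (g x₀ (ξ 0 ω)) x₀
    rw [h1] at h2
    by_contra hgne
    have : 0 < (a - 1) * (‖g x₀ (ξ 0 ω)‖ * ‖xs - x₀‖) :=
      mul_pos (by linarith) (mul_pos (norm_pos_iff.2 hgne) hr)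
    linarith
  have hgm : Measurable (g x₀) := hg.measurable.comp measurable_prodMk_left
  have h1 : ∫ s, g x₀ s ∂Q = 0 := by
    rw [← (hξ 0).integral_comp hgm.aestronglyMeasurable]
    exact integral_eq_zero_of_ae h0
  rw [hg.unbiased] at h1
  have h2 := hPL.2 x₀
  rw [h1, norm_zero, zero_pow two_ne_zero] at h2
  have h3 := hxs.1 x₀
  exact hne (hxs.2 _ (by nlinarith [hPL.1]))

end Clock

theorem le_measureReal_of_ae {Ω : Type*} [MeasurableSpace Ω] {P : Measure Ω}
    [IsProbabilityMeasure P] {p : Ω → Prop} (hp : ∀ᵐ ω ∂P, p ω) {c e : ℝ} (hc : 1 < c) :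
    1 - 1 / c - Real.exp e ≤ P.real {ω | p ω} := by
  have h1 : P.real {ω | p ω} = 1 := by
    rw [measureReal_def, measure_congr (eventuallyEq_univ.2 hp), measure_univ, ENNReal.toReal_one]
  have h2 : 0 < 1 / c := by positivity
  linarith [Real.exp_pos e]

end PLMomentum

/-! ### Exceptional cases, then Markov's inequality and the clock. -/

open PLMomentum Set Filter in
theorem mainTheorem5 {d : ℕ} {Ω Ξ : Type*} [MeasurableSpace Ω] [MeasurableSpace Ξ]
    (P : Measure Ω) [IsProbabilityMeasure P] (Q : Measure Ξ) [IsProbabilityMeasure Q]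
    -- the objective and its constants
    (f : PLMomentum.Vec d → ℝ) (xs : PLMomentum.Vec d) (μ L μ₀ L₀ : ℝ)
    (hf : ContDiff ℝ 1 f) (hxs : PLMomentum.IsUniqueMinimizer f xs)
    (hPL : PLMomentum.IsPL μ f xs) (hLS : PLMomentum.IsLSmooth L f)
    (hL₀ : L₀ = sInf {L' : ℝ | L' ≤ L ∧ PLMomentum.QGUpper L' f xs})
    (hμ₀ : μ₀ = sSup {μ' : ℝ | μ ≤ μ' ∧ PLMomentum.QGLower μ' f xs})
    -- the stochastic gradients and the sources of randomness
    (g : PLMomentum.Vec d → Ξ → PLMomentum.Vec d) (ρ : ℝ)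
    (hg : PLMomentum.StrongGrowth f g Q ρ)
    (T : ℕ → Ω → ℝ) (ξ : ℕ → Ω → Ξ) (hTξ : PLMomentum.IsMarkedPoissonClock P Q T ξ)
    -- the parameters
    (a θ η η' γ γ' : ℝ) (ha : 0 < a)
    (hθ : θ = a / ρ * (μ₀ / L₀) ^ (1 / 4 : ℝ) * √(μ / L))
    (hη' : η' = θ)
    (hγ : γ = 1 / (ρ * L))
    (hγ' : γ' = 1 / (ρ * (μ₀ * L₀) ^ (1 / 4 : ℝ) * √L))
    (hη : η = 1 / ρ * ((μ₀ * L₀) ^ (1 / 4 : ℝ) / √L))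
    -- the iterates, started at `x̃₀ = z̃₀ = x₀`
    (x₀ : PLMomentum.Vec d) (x y z : ℕ → Ω → PLMomentum.Vec d)
    (hx₀ : ∀ ω, x 0 ω = x₀) (hz₀ : ∀ ω, z 0 ω = x₀)
    (hNM : ∀ ω, PLMomentum.IsNesterov
      (fun k => PLMomentum.contAlpha η η' (T (k + 1) ω - T k ω))
      (fun k => PLMomentum.contBeta η η' (T (k + 1) ω - T k ω))
      γ γ' (fun k v => g v (ξ k ω)) (fun k => x k ω) (fun k => y k ω) (fun k => z k ω))
    -- the averaged aiming condition up to the iteration `k` that is considered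
    (k : ℕ)
    (hAim : PLMomentum.AveragedAiming P g xs a (fun i ω => Real.exp (θ * T i ω)) y ξ k)
    (c₀ c₁ : ℝ) (hc₀ : 1 < c₀) (hc₁ : c₁ ∈ Set.Ioo (0 : ℝ) 1) :
    1 - 1 / c₀ - Real.exp (-((1 - c₁) - 1 - Real.log (1 - c₁)) * k) ≤
      P.real {ω | f (x k ω) - f xs ≤
        c₀ * (1 + √(L₀ / μ₀)) * (f x₀ - f xs) * Real.exp (-θ * (1 - c₁) * k)} := by
  subst hη'
  have hL := hLS.1
  have hμ := hPL.1
  have hρ := hg.one_le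
  have hbase : 0 ≤ f x₀ - f xs := sub_nonneg.2 (hxs.1 x₀)
  have hrhs : 0 ≤ c₀ * (1 + √(L₀ / μ₀)) * (f x₀ - f xs) * Real.exp (-η' * (1 - c₁) * k) := by
    have : 0 < c₀ := by linarith
    positivity
  have hξ := hTξ.hasLaw_mark
  -- For k = 0 the probability bound is −1/c₀, hence void; aiming gives no information on a there.
  rcases Nat.eq_zero_or_pos k with rfl | hk
  · have h2 : 0 < 1 / c₀ := by positivity
    refine le_trans ?_ measureReal_nonneg
    simp only [Nat.cast_zero, mul_zero, Real.exp_zero]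
    linarith
  -- A point other than x* is needed to order μ₀ and L₀: for d = 0 the set defining μ₀ is unbounded.
  rcases eq_or_ne x₀ xs with hx | hne
  · subst hx
    refine le_measureReal_of_ae ?_ hc₀
    filter_upwards [ae_eq_minimizer_of_start hxs hg hξ hx₀ hz₀ hNM k] with ω hω
    rw [hω, sub_self]
    simp
  have ha1 : a ≤ 1 := by
    by_contra! hlt
    exact hne (start_eq_minimizer_of_one_lt hxs hPL hg hξ hx₀ hz₀ hNM hk hlt hAim)
  obtain ⟨hlow, hup, hμμ₀, hμL, hLL⟩ :=
    sharp_growth_constants hf.continuous hPL hLS hxs hL₀ hμ₀ hne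
  have hp := lyapunovParams_of_sharp_constants hPL hLS hlow hup hρ ha hθ hγ hγ' hη
  have hms := measurable_stepMap hg.measurable η η' γ γ'
  let S : ℕ → Ω → State d := fun j ω => (T j ω, x j ω, z j ω)
  let u : ℕ → Ω → ℝ × Ξ := fun j ω => (T (j + 1) ω - T j ω, ξ j ω)
  have h0 : ∀ ω, S 0 ω = (0, x₀, x₀) := fun ω => by simp [S, hTξ.zero, hx₀, hz₀]
  have hy : ∀ j ω, gradPoint η η' (S j ω, u j ω) = y j ω := fun j ω => ((hNM ω).y_eq j).symm
  have hS : ∀ j ω, S (j + 1) ω = stepMap g η η' γ γ' (S j ω, u j ω) := fun j ω => by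
    have h1 := (hNM ω).x_succ j
    have h2 := (hNM ω).z_succ j
    simp only [stepMap, hy, S, u, add_sub_cancel, flowZ]
    have h3 : flowX η η' (x j ω) (z j ω) (T (j + 1) ω - T j ω) = y j ω := hy j ω
    rw [h3]
    exact Prod.ext rfl (Prod.ext h1 h2)
  rcases rate_lt_one_or hμ hμμ₀ hμL hLL hρ ha ha1 hθ with hθ1 | ⟨rfl, rfl⟩
  · obtain ⟨hVi, hVle⟩ := expected_lyapunov_le (S := S) hf hLS hxs hg hp hθ1 hTξ.law hTξ.indep
      h0 hS k (by
        filter_upwards [hAim] with ω hω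
        rw [← neg_nonneg, ← Finset.sum_neg_distrib]
        refine hω.trans_eq (Finset.sum_congr rfl fun j _ => ?_)
        have := hy j ω
        simp only [weightedDeficit, aimingDeficit]
        simp only [u, S] at this ⊢
        rw [this, add_sub_cancel]
        ring)
    have hF0 : 0 < f x₀ - f xs :=
      hbase.lt_of_ne fun h => hne (hxs.2 _ (sub_eq_zero.1 h.symm))
    have hV0 : weightedLyapunov f xs (μ₀ * √(L₀ / μ₀)) η' (0, x₀, x₀) ≤
        (1 + √(L₀ / μ₀)) * (f x₀ - f xs) := by
      have := mul_le_mul_of_nonneg_left (hlow.2 x₀) (Real.sqrt_nonneg (L₀ / μ₀))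
      simp only [weightedLyapunov, lyapunov, mul_zero, Real.exp_zero]
      linarith
    have hΛ : 0 < c₀ * ((1 + √(L₀ / μ₀)) * (f x₀ - f xs)) := by positivity
    have hmarkov := mul_meas_ge_le_integral_of_nonneg (μ := P)
      (Eventually.of_forall fun ω => weightedLyapunov_nonneg (θ := η') hxs hp.b_pos (S k ω))
      hVi (c₀ * ((1 + √(L₀ / μ₀)) * (f x₀ - f xs)))
    have hm2 : P.real {ω | c₀ * ((1 + √(L₀ / μ₀)) * (f x₀ - f xs)) ≤
        weightedLyapunov f xs (μ₀ * √(L₀ / μ₀)) η' (S k ω)} ≤ 1 / c₀ := by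
      rw [le_div_iff₀ (by linarith)]
      refine le_of_mul_le_mul_right (a := (1 + √(L₀ / μ₀)) * (f x₀ - f xs)) ?_ (by positivity)
      linarith
    have htail := hTξ.lower_tail k hc₁
    -- Off the two bad events, T_k > (1 − c₁)k turns the random weight e^{θT_k} into the
    -- deterministic rate.
    have hcover : (univ : Set Ω) ⊆ {ω | f (x k ω) - f xs ≤
        c₀ * (1 + √(L₀ / μ₀)) * (f x₀ - f xs) * Real.exp (-η' * (1 - c₁) * k)} ∪
        ({ω | c₀ * ((1 + √(L₀ / μ₀)) * (f x₀ - f xs)) ≤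
          weightedLyapunov f xs (μ₀ * √(L₀ / μ₀)) η' (S k ω)} ∪
        {ω | T k ω ≤ (1 - c₁) * k}) := by
      intro ω _
      by_contra! hcon
      simp only [mem_union, mem_ofPred_eq, not_or, not_le] at hcon
      obtain ⟨n1, n2, n3⟩ := hcon
      have hz : 0 ≤ μ₀ * √(L₀ / μ₀) / 2 * ‖z k ω - xs‖ ^ 2 := by
        have := hp.b_pos; positivity
      have e1 : Real.exp (η' * ((1 - c₁) * k)) ≤ Real.exp (η' * T k ω) := by
        have := hp.θ_pos
        gcongr
      have e2 : Real.exp (-η' * (1 - c₁) * k) * Real.exp (η' * ((1 - c₁) * k)) = 1 := by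
        rw [← Real.exp_add, Real.exp_eq_one_iff]; ring
      have e3 := mul_lt_mul_of_pos_right n1 (Real.exp_pos (η' * ((1 - c₁) * k)))
      rw [mul_assoc _ (Real.exp _), e2] at e3
      have e4 : (f (x k ω) - f xs) * Real.exp (η' * ((1 - c₁) * k)) ≤
          Real.exp (η' * T k ω) * lyapunov f xs (μ₀ * √(L₀ / μ₀)) (x k ω) (z k ω) := by
        have := sub_nonneg.2 (hxs.1 (x k ω))
        rw [mul_comm]
        unfold lyapunov
        gcongr
        linarith
      simp only [weightedLyapunov, S] at n2
      linarith
    have hu := (measureReal_mono hcover (measure_ne_top P _)).trans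
      ((measureReal_union_le _ _).trans (add_le_add_right (measureReal_union_le _ _) _))
    rw [probReal_univ] at hu
    linarith
  · refine le_measureReal_of_ae ?_ hc₀
    -- Only the last step matters: its noise is independent of the state and waiting time, and γ =
    -- 1/L.
    obtain ⟨j, rfl⟩ := Nat.exists_eq_succ_of_ne_zero hk.ne'
    have := isProbabilityMeasure_expMeasure one_pos
    have hlaw := (hasLaw_state_prod hTξ.law hTξ.indep hms h0 hS j).2
    have hfm := hf.continuous.measurable
    have hae : ∀ᵐ p ∂((P.map (S j)).prod ((expMeasure 1).prod Q)),
        f (stepMap g η η' γ γ' p).2.1 = f xs := by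
      have hset : MeasurableSet {p | f (stepMap g η η' γ γ' p).2.1 = f xs} :=
        measurableSet_eq_fun (hfm.comp (measurable_fst.comp (measurable_snd.comp hms)))
          measurable_const
      rw [Measure.ae_prod_iff_ae_ae hset]
      refine Eventually.of_forall fun s => ?_
      rw [Measure.ae_prod_iff_ae_ae (p := fun u => f (stepMap g η η' γ γ' (s, u)).2.1 = f xs)
        (measurable_prodMk_left hset)]
      refine Eventually.of_forall fun δ => ?_
      rw [one_mul] at hγ
      rw [hγ]
      exact ae_gradient_step_eq_min hf hxs hPL hLS hg (flowX η η' s.2.1 s.2.2 δ)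
    filter_upwards [ae_comp_of_hasLaw hlaw hae] with ω hω
    rw [← hS] at hω
    change f (x (j + 1) ω) = f xs at hω
    rw [hω, sub_self]
    exact hrhs
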